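/- **Setting and terminology.** Let $F\colon\mathcal K\to\mathcal L$ be a functor of augmented virtual double categories (in the sense of Koudenburg): these have objects, vertical morphisms $A\to C$ (forming a category), horizontal morphisms $A⇸B$, and cells whose horizontal source is a path $\underline H$ of horizontal morphisms and whose horizontal target is a path of length one (unary cells) or zero (nullary cells, written $\underline H\Rightarrow C$); cells with empty source and empty target are called vertical cells; $\odot$ denotes horizontal composition of cells, and $e\circ\phi:=\mathrm{id}_e\circ\phi$. * A cell $\psi$ with source of length $\le 1$ is *cartesian* if every cell with the same horizontal target, whose vertical boundary factors through that of $\psi$, factors uniquely through $\psi$. A cartesian cell with source $J$ and target $K$, respectively $C$, and with vertical boundary $f,g$, exhibits $J$ as the *restriction* $K(f,g)$, respectively $C(f,g)$. The *companion* of $f\colon A\to C$ is $f_*:=C(f,\mathrm{id})$; an object $A$ is *unital* if $A(\mathrm{id},\mathrm{id})$ exists; $f$ is *full and faithful* if $\mathrm{id}_f$ is cartesian. * A nullary cell $\eta\colon\underline J\Rightarrow M$ with vertical boundary $d,l$ is *left Kan* (and $l$ is the *left Kan extension* of $d$ along $\underline J$) if every nullary cell $\phi\colon\underline J\frown\underline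 H\Rightarrow M$ with vertical source $d$ factors uniquely as $\phi=\eta\odot\phi'$. A morphism $\mathrm y\colon A\to M$ is *dense* if all cartesian nullary cells $J\Rightarrow M$ ($J$ a single horizontal morphism) with vertical source $\mathrm y$ are left Kan; it is a *Yoneda morphism* if it is dense and satisfies the *Yoneda axiom*: for each $J\colon A⇸B$ there is $J^\lambda\colon B\to M$ with a cartesian cell exhibiting $J= M(\mathrm y,J^\lambda)$. A *Yoneda embedding* is a full and faithful Yoneda morphism. * A horizontal cell $\phi\colon(H_1,H_2)\Rightarrow J$ is *right cocartesian* if, for each path $\underline K$ starting at the common end of $H_2$ and $J$, each (nullary or unary) cell with source $(H_1,H_2)\frown\underline K$ factors uniquely through the path $(\phi,\mathrm{id}_{\underline K})$. It is *pointwise right cocartesian*, and $J$ is the *pointwise right composite* $H_1\odot H_2$, if moreover, whenever a restriction $H_2(\mathrm{id},f)$ exists, $J(\mathrm{id},f)$ exists too and the induced cell $(H_1,H_2(\mathrm{id},f))\Rightarrow J(\mathrm{id},f)$ is again right cocartesian. * For $X\in\mathcal L$ the category $F/X$ has as objects the morphisms $f\colon FA\to X$ with $A\in\mathcal K$; a morphism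 from $f\colon FA\to X$ to $g\colon FC\to X$ is a path $\underline H\colon A⇸C$ in $\mathcal K$ together with a nullary cell $F\underline H\Rightarrow X$ with vertical boundary $f,g$; composition is $\odot$. For $X'\in\mathcal K$ put $\mathcal K/X':=\mathrm{id}_{\mathcal K}/X'$. A morphism $\varepsilon\colon FX'\to X$ is *universal from $F$ to $X$ relative to* a full subcategory $\mathcal J\subseteq F/X$ if $\varepsilon\circ F(-)\colon\mathcal K/X'\to F/X$ is full and faithful and factors through $\mathcal J$ as an equivalence $\mathcal K/X'\simeq\mathcal J$. For $\iota\colon A⇸FA'$ in $\mathcal L$ (with $A\in\mathcal L$, $A'\in\mathcal K$) consider the conditions: (a) for each $J\colon A'⇸B$ in $\mathcal K$ the pointwise right composite $J^\flat:=\iota\odot FJ\colon A⇸FB$ (the *adjunct* of $J$) exists; (b) for each $h\colon X\to A'$ in $\mathcal K$ the restriction $\iota(\mathrm{id},Fh)$ exists; (c) for all $J\colon A'⇸B$, $h\colon X_0\to A'$, $k\colon X_n\to B$ and $\underline H\colon X_0⇸X_n$ in $\mathcal K$, the assignment $\phi\mapsto\mathrm{cocart}\circ(\mathrm{cart},F\phi)$,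 with $\mathrm{cart}$ and $\mathrm{cocart}$ defining $\iota(\mathrm{id},Fh)$ and $J^\flat$, is a bijection from the cells $\underline H\Rightarrow J$ with vertical boundary $h,k$ onto the cells $\iota(\mathrm{id},Fh)\frown F\underline H\Rightarrow J^\flat$ with vertical boundary $\mathrm{id}_A,Fk$. If (a), (b) and (c) hold then $\iota$ is called *locally universal from $A$ to $F$*. **Data.** Let $\mathrm y_A\colon A\to P_A$ be a Yoneda morphism in $\mathcal L$, let $A'\in\mathcal K$ be unital, and let $\iota\colon A⇸FA'$ satisfy (a) and (b). A morphism $f\colon FB\to P_A$ is called *$\iota$-small* if it is the left Kan extension of $\mathrm y_A$ along $J^\flat$ for some $J\colon A'⇸B$. Let $\varepsilon\colon FP_{A'}\to P_A$ be universal from $F$ to $P_A$ relative to the full subcategory of $F/P_A$ generated by the $\iota$-small morphisms. **Construction.** The Yoneda axiom for $\mathrm y_A$ supplies $\iota^\lambda\colon FA'\to P_A$ and, for each $J\colon A'⇸B$ in $\mathcal K$, $(J^\flat)^\lambda\colon FB\to P_A$, together with defining cartesian cells $\mathrm{cart}_{\iota^\lambda}$ and $\mathrm{cart}_{(J^\flat)^\lambda}$.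 These morphisms are $\iota$-small, so one can choose $\mathrm y_{A'}\colon A'\to P_{A'}$ and $J^{\lambda'}\colon B\to P_{A'}$ with invertible vertical cells $\sigma\colon\iota^\lambda\cong\varepsilon\circ F\mathrm y_{A'}$ and $\tau_J\colon\varepsilon\circ FJ^{\lambda'}\cong(J^\flat)^\lambda$. There is a unique nullary cell $\chi^J\colon FJ\Rightarrow P_A$ with $\mathrm{cart}_{(J^\flat)^\lambda}\circ\mathrm{cocart}=\mathrm{cart}_{\iota^\lambda}\odot\chi^J$, and a unique nullary cell $\chi^{J\sharp}\colon J\Rightarrow P_{A'}$, with vertical boundary $\mathrm y_{A'},J^{\lambda'}$, such that $\chi^J=\sigma\odot(\varepsilon\circ F\chi^{J\sharp})\odot\tau_J$. **Theorem.** In this situation all choices above can be made and, for any such choices, the cells $\chi^{J\sharp}$ exist uniquely, and the following hold. 1. $\iota$ is locally universal from $A$ to $F$ (that is, (c) holds) if and only if, for each $J\colon A'⇸B$ in $\mathcal K$, the cell $\chi^{J\sharp}$ is cartesian; that is, if and only if $\mathrm y_{A'}$ satisfies the Yoneda axiom by means of the morphisms $J^{\lambda'}$ and the cells $\chi^{J\sharp}$.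 In particular, if $\iota$ is locally universal then $\mathrm y_{A'}$ satisfies the Yoneda axiom. 2. Suppose that the companion $\mathrm y_{A'*}\colon A'⇸P_{A'}$ exists and that, for every $f\colon B\to P_{A'}$ in $\mathcal K$, the restrictions $\mathrm y_{A'*}(\mathrm{id},f)$ and $(\mathrm y_{A'*})^\flat(\mathrm{id},Ff)$ exist and $F$ preserves (the cartesian cells defining) $\mathrm y_{A'*}(\mathrm{id},f)$. Suppose moreover that $\iota$ is locally universal from $A$ to $F$. Then $\mathrm y_{A'}$ is a Yoneda embedding in $\mathcal K$, each cell $\chi^{J\sharp}$ is cartesian, and $(\mathrm y_{A'*})^\flat\colon A⇸FP_{A'}$ is the restriction $P_A(\mathrm y_A,\varepsilon)$ of $P_A$ along $\mathrm y_A$ and $\varepsilon$. -/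

import Mathlib

open CategoryTheory

namespace AugVirt

/-- Paths `(J₁, …, Jₙ)`, `n ≥ 0`, of horizontal morphisms. -/
inductive HPath.{u, w} {Ob : Type u} (Hor : Ob → Ob → Type w) : Ob → Ob → Type (max u w)
  | nil (A : Ob) : HPath Hor A A
  | cons {A B C : Ob} (J : Hor A B) (P : HPath Hor B C) : HPath Hor A C

namespace HPath

/-- The path consisting of a single horizontal morphism. -/
def of.{u, w} {Ob : Type u} {Hor : Ob → Ob → Type w} {A B : Ob} (J : Hor A B) : HPath Hor A B :=
  .cons J (.nil B)

/-- Concatenation of paths. -/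
def comp.{u, w} {Ob : Type u} {Hor : Ob → Ob → Type w} :
    ∀ {A B C : Ob}, HPath Hor A B → HPath Hor B C → HPath Hor A C
  | _, _, _, .nil _, Q => Q
  | _, _, _, .cons J P, Q => .cons J (P.comp Q)

theorem comp_nil.{u, w} {Ob : Type u} {Hor : Ob → Ob → Type w} {A B : Ob} (P : HPath Hor A B) :
    P.comp (.nil B) = P := by
  induction P with
  | nil A => rfl
  | cons J P ih => simp only [comp, ih]

theorem comp_assoc.{u, w} {Ob : Type u} {Hor : Ob → Ob → Type w} {A B C D : Ob}
    (P : HPath Hor A B) (Q : HPath Hor B C) (R : HPath Hor C D) :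
    (P.comp Q).comp R = P.comp (Q.comp R) := by
  induction P with
  | nil A => rfl
  | cons J P ih => simp only [comp, ih]

end HPath

/-- Horizontal targets of cells: paths of length at most one. -/
inductive HTarget.{u, w} {Ob : Type u} (Hor : Ob → Ob → Type w) : Ob → Ob → Type (max u w)
  | nul (C : Ob) : HTarget Hor C C
  | un {C D : Ob} (J : Hor C D) : HTarget Hor C D

/-- A horizontal target regarded as a path. -/
def HTarget.toPath.{u, w} {Ob : Type u} {Hor : Ob → Ob → Type w} :
    ∀ {C D : Ob}, HTarget Hor C D → HPath Hor C D
  | _, _, .nul C => .nil C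
  | _, _, .un J => .of J

/-- Objects, the category of vertical morphisms, horizontal morphisms, and cells. A cell in
`Cell P f g T` has horizontal source the path `P`, vertical source `f`, vertical target `g` and
horizontal target `T`. -/
structure Graph.{u, v, w, x} where
  Obj : Type u
  [vert : Category.{v} Obj]
  Hor : Obj → Obj → Type w
  Cell : ∀ {A B C D : Obj}, HPath Hor A B → (A ⟶ C) → (B ⟶ D) → HTarget Hor C D → Type x

attribute [instance] Graph.vert

/-- Paths `(φ₁, …, φₙ)`, `n ≥ 1`, of cells, consecutive cells having a common vertical boundary.
A member of `CellSeq G P f g Q` has horizontal source `P` (the concatenation of the horizontal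
sources of the cells), vertical boundary `f`, `g`, and horizontal target `Q` (the concatenation of
the horizontal targets). The equalities in the constructors only identify `P` and `Q`. -/
inductive CellSeq.{u, v, w, x} (G : Graph.{u, v, w, x}) :
    ∀ {A B C D : G.Obj}, HPath G.Hor A B → (A ⟶ C) → (B ⟶ D) → HPath G.Hor C D →
      Type (max u v w x)
  | single {A B C D : G.Obj} {P : HPath G.Hor A B} {f : A ⟶ C} {g : B ⟶ D}
      {T : HTarget G.Hor C D} {Q : HPath G.Hor C D} (φ : G.Cell P f g T) (hQ : Q = T.toPath) :
      CellSeq G P f g Q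
  | cons {A X B C Y D : G.Obj} {P₁ : HPath G.Hor A X} {P₂ : HPath G.Hor X B}
      {f : A ⟶ C} {m : X ⟶ Y} {g : B ⟶ D} {T : HTarget G.Hor C Y} {Q₂ : HPath G.Hor Y D}
      {P : HPath G.Hor A B} {Q : HPath G.Hor C D}
      (φ : G.Cell P₁ f m T) (s : CellSeq G P₂ m g Q₂)
      (hP : P = P₁.comp P₂) (hQ : Q = T.toPath.comp Q₂) : CellSeq G P f g Q

/-- Concatenation of paths of cells. -/
def CellSeq.append.{u, v, w, x} {G : Graph.{u, v, w, x}} :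
    ∀ {A X B C Y D : G.Obj} {P₁ : HPath G.Hor A X} {P₂ : HPath G.Hor X B}
      {f : A ⟶ C} {m : X ⟶ Y} {g : B ⟶ D} {Q₁ : HPath G.Hor C Y} {Q₂ : HPath G.Hor Y D}
      {P : HPath G.Hor A B} {Q : HPath G.Hor C D},
      CellSeq G P₁ f m Q₁ → CellSeq G P₂ m g Q₂ → P = P₁.comp P₂ → Q = Q₁.comp Q₂ →
      CellSeq G P f g Q
  | _, _, _, _, _, _, _, _, _, _, _, _, _, _, _, .single φ hQ₁, t, hP, hQ =>
      .cons φ t hP (by rw [hQ, hQ₁])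
  | _, _, _, _, _, _, _, _, _, _, _, _, _, _, _, .cons φ s hP₁ hQ₁, t, hP, hQ =>
      .cons φ (s.append t rfl rfl) (by rw [hP, hP₁, HPath.comp_assoc])
        (by rw [hQ, hQ₁, HPath.comp_assoc])

/-- Pairs consisting of a path of cells `(ψ₁, …, ψₙ)` and, above each `ψᵢ`, a path of cells
`(φᵢ₁, …, φᵢₘ)` that is composable with `ψᵢ`. -/
inductive CellGrid.{u, v, w, x} (G : Graph.{u, v, w, x}) :
    ∀ {A B C D E F : G.Obj}, HPath G.Hor A B → (A ⟶ C) → (B ⟶ D) → HPath G.Hor C D →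
      (C ⟶ E) → (D ⟶ F) → HPath G.Hor E F → Type (max u v w x)
  | single {A B C D E F : G.Obj} {P : HPath G.Hor A B} {f : A ⟶ C} {g : B ⟶ D}
      {Q : HPath G.Hor C D} {h : C ⟶ E} {k : D ⟶ F} {T : HTarget G.Hor E F}
      {R : HPath G.Hor E F} (s : CellSeq G P f g Q) (ψ : G.Cell Q h k T) (hR : R = T.toPath) :
      CellGrid G P f g Q h k R
  | cons {A X B C Y D E Z F : G.Obj} {P₁ : HPath G.Hor A X} {P₂ : HPath G.Hor X B}
      {f : A ⟶ C} {m : X ⟶ Y} {g : B ⟶ D} {Q₁ : HPath G.Hor C Y} {Q₂ : HPath G.Hor Y D}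
      {h : C ⟶ E} {l : Y ⟶ Z} {k : D ⟶ F} {T : HTarget G.Hor E Z} {R₂ : HPath G.Hor Z F}
      {P : HPath G.Hor A B} {Q : HPath G.Hor C D} {R : HPath G.Hor E F}
      (s : CellSeq G P₁ f m Q₁) (ψ : G.Cell Q₁ h l T) (t : CellGrid G P₂ m g Q₂ l k R₂)
      (hP : P = P₁.comp P₂) (hQ : Q = Q₁.comp Q₂) (hR : R = T.toPath.comp R₂) :
      CellGrid G P f g Q h k R

/-- The concatenated path `(φ₁₁, …, φₙₘ)`. -/
def CellGrid.upper.{u, v, w, x} {G : Graph.{u, v, w, x}} :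
    ∀ {A B C D E F : G.Obj} {P : HPath G.Hor A B} {f : A ⟶ C} {g : B ⟶ D} {Q : HPath G.Hor C D}
      {h : C ⟶ E} {k : D ⟶ F} {R : HPath G.Hor E F},
      CellGrid G P f g Q h k R → CellSeq G P f g Q
  | _, _, _, _, _, _, _, _, _, _, _, _, _, .single s _ _ => s
  | _, _, _, _, _, _, _, _, _, _, _, _, _, .cons s _ t hP hQ _ => s.append t.upper hP hQ

/-- The path `(ψ₁, …, ψₙ)`. -/
def CellGrid.lower.{u, v, w, x} {G : Graph.{u, v, w, x}} :
    ∀ {A B C D E F : G.Obj} {P : HPath G.Hor A B} {f : A ⟶ C} {g : B ⟶ D} {Q : HPath G.Hor C D}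
      {h : C ⟶ E} {k : D ⟶ F} {R : HPath G.Hor E F},
      CellGrid G P f g Q h k R → CellSeq G Q h k R
  | _, _, _, _, _, _, _, _, _, _, _, _, _, .single _ ψ hR => .single ψ hR
  | _, _, _, _, _, _, _, _, _, _, _, _, _, .cons _ ψ t _ hQ hR => .cons ψ t.lower hQ hR

/-- The operations of an augmented virtual double category: vertical composition
`ψ ∘ (φ₁, …, φₙ)` along paths of cells of length `n ≥ 1`, horizontal identity cells `id_J`
and vertical identity cells `id_f`. The equalities among the arguments allow the vertical boundary
of the result to be any morphisms equal to the expected ones. -/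
structure Ops.{u, v, w, x} extends Graph.{u, v, w, x} where
  comp : ∀ {A B C D E F : Obj} {P : HPath Hor A B} {Q : HPath Hor C D} {f : A ⟶ C} {g : B ⟶ D}
    {h : C ⟶ E} {k : D ⟶ F} {T : HTarget Hor E F} {f' : A ⟶ E} {g' : B ⟶ F},
    CellSeq toGraph P f g Q → Cell Q h k T → f ≫ h = f' → g ≫ k = g' → Cell P f' g' T
  idH : ∀ {A B : Obj} (J : Hor A B) {a : A ⟶ A} {b : B ⟶ B}, a = 𝟙 A → b = 𝟙 B →
    Cell (HPath.of J) a b (HTarget.un J)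
  idV : ∀ {A C : Obj} (f : A ⟶ C), Cell (HPath.nil A) f f (HTarget.nul C)

/-- The path `(ψ₁ ∘ (φ₁₁, …), …, ψₙ ∘ (φₙ₁, …))` of composites. -/
def Ops.comps.{u, v, w, x} (K : Ops.{u, v, w, x}) :
    ∀ {A B C D E F : K.Obj} {P : HPath K.Hor A B} {f : A ⟶ C} {g : B ⟶ D} {Q : HPath K.Hor C D}
      {h : C ⟶ E} {k : D ⟶ F} {R : HPath K.Hor E F},
      CellGrid K.toGraph P f g Q h k R → CellSeq K.toGraph P (f ≫ h) (g ≫ k) R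
  | _, _, _, _, _, _, _, _, _, _, _, _, _, .single s ψ hR => .single (K.comp s ψ rfl rfl) hR
  | _, _, _, _, _, _, _, _, _, _, _, _, _, .cons s ψ t hP _ hR =>
      .cons (K.comp s ψ rfl rfl) (K.comps t) hP hR

/-- The path `(id_{J₁}, …, id_{Jₙ})` of identity cells, which is `(id_{id_A})` for the empty path
at `A`. -/
def Ops.idSeq.{u, v, w, x} (K : Ops.{u, v, w, x}) :
    ∀ {A B : K.Obj} (P : HPath K.Hor A B), CellSeq K.toGraph P (𝟙 A) (𝟙 B) P
  | _, _, .nil A => .single (K.idV (𝟙 A)) rfl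
  | _, _, .cons J (.nil _) => .single (K.idH J rfl rfl) rfl
  | _, _, .cons J (.cons J' P) => .cons (K.idH J rfl rfl) (K.idSeq (.cons J' P)) rfl rfl

end AugVirt

open AugVirt in
/-- Augmented virtual double categories. -/
structure AugVDC.{u, v, w, x} extends AugVirt.Ops.{u, v, w, x} where
  /-- `χ ∘ (ψ₁ ∘ (φ₁₁, …), …, ψₙ ∘ (φₙ₁, …)) = (χ ∘ (ψ₁, …, ψₙ)) ∘ (φ₁₁, …, φₙₘ)` -/
  assoc : ∀ {A B C D E F X Y : Obj} {P : HPath Hor A B} {f : A ⟶ C} {g : B ⟶ D}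
    {Q : HPath Hor C D} {h : C ⟶ E} {k : D ⟶ F} {R : HPath Hor E F} {p : E ⟶ X} {q : F ⟶ Y}
    {T : HTarget Hor X Y} (c : CellGrid toGraph P f g Q h k R) (χ : Cell R p q T),
    comp (toOps.comps c) χ (Category.assoc f h p) (Category.assoc g k q) =
      comp c.upper (comp c.lower χ rfl rfl) rfl rfl
  idH_comp : ∀ {A B C D : Obj} {P : HPath Hor A B} {f : A ⟶ C} {g : B ⟶ D} {J : Hor C D}
    (φ : Cell P f g (.un J)),
    comp (.single φ rfl) (idH J rfl rfl) (Category.comp_id f) (Category.comp_id g) = φ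
  idV_comp : ∀ {A B C : Obj} {P : HPath Hor A B} {f : A ⟶ C} {g : B ⟶ C}
    (φ : Cell P f g (.nul C)),
    comp (.single φ rfl) (idV (𝟙 C)) (Category.comp_id f) (Category.comp_id g) = φ
  comp_id : ∀ {A B C D : Obj} {P : HPath Hor A B} {f : A ⟶ C} {g : B ⟶ D} {T : HTarget Hor C D}
    (φ : Cell P f g T),
    comp (toOps.idSeq P) φ (Category.id_comp f) (Category.id_comp g) = φ
  idV_comp_idV : ∀ {A C E : Obj} (f : A ⟶ C) (h : C ⟶ E),
    comp (.single (idV f) rfl) (idV h) rfl rfl = idV (f ≫ h)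
  /-- `ψ ∘ (id_{f₀}, φ₁, …, φₙ) = ψ ∘ (φ₁, …, φₙ)` -/
  insert_left : ∀ {A B C D E F : Obj} {P : HPath Hor A B} {Q : HPath Hor C D} {f : A ⟶ C}
    {g : B ⟶ D} {h : C ⟶ E} {k : D ⟶ F} {T : HTarget Hor E F}
    (s : CellSeq toGraph P f g Q) (ψ : Cell Q h k T),
    comp (.cons (idV f) s rfl rfl) ψ rfl rfl = comp s ψ rfl rfl
  /-- `ψ ∘ (φ₁, …, φₙ, id_{fₙ}) = ψ ∘ (φ₁, …, φₙ)` -/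
  insert_right : ∀ {A B C D E F : Obj} {P : HPath Hor A B} {Q : HPath Hor C D} {f : A ⟶ C}
    {g : B ⟶ D} {h : C ⟶ E} {k : D ⟶ F} {T : HTarget Hor E F}
    (s : CellSeq toGraph P f g Q) (ψ : Cell Q h k T),
    comp (s.append (.single (idV g) rfl) (HPath.comp_nil P).symm (HPath.comp_nil Q).symm)
      ψ rfl rfl = comp s ψ rfl rfl
  /-- `ψ ∘ (φ₁, …, φᵢ, id_{fᵢ}, φᵢ₊₁, …, φₙ) = ψ ∘ (φ₁, …, φₙ)` -/
  insert_middle : ∀ {A X B C Y D E F : Obj} {P₁ : HPath Hor A X} {P₂ : HPath Hor X B}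
    {Q₁ : HPath Hor C Y} {Q₂ : HPath Hor Y D} {f : A ⟶ C} {m : X ⟶ Y}
    {g : B ⟶ D} {h : C ⟶ E} {k : D ⟶ F} {T : HTarget Hor E F}
    (s : CellSeq toGraph P₁ f m Q₁) (t : CellSeq toGraph P₂ m g Q₂)
    (ψ : Cell (Q₁.comp Q₂) h k T),
    comp (s.append (.cons (idV m) t rfl rfl) (P := P₁.comp P₂) rfl rfl) ψ rfl rfl =
      comp (s.append t rfl rfl) ψ rfl rfl

namespace AugVirt

/-- The image of a path of horizontal morphisms. -/
def HPath.map.{u, w, u', w'} {Ob : Type u} {Hor : Ob → Ob → Type w} {Ob' : Type u'}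
    {Hor' : Ob' → Ob' → Type w'} (o : Ob → Ob')
    (m : ∀ {A B : Ob}, Hor A B → Hor' (o A) (o B)) :
    ∀ {A B : Ob}, HPath Hor A B → HPath Hor' (o A) (o B)
  | _, _, .nil A => .nil (o A)
  | _, _, .cons J P => .cons (m J) (HPath.map o m P)

/-- The image of a horizontal target. -/
def HTarget.map.{u, w, u', w'} {Ob : Type u} {Hor : Ob → Ob → Type w} {Ob' : Type u'}
    {Hor' : Ob' → Ob' → Type w'} (o : Ob → Ob')
    (m : ∀ {A B : Ob}, Hor A B → Hor' (o A) (o B)) :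
    ∀ {A B : Ob}, HTarget Hor A B → HTarget Hor' (o A) (o B)
  | _, _, .nul A => .nul (o A)
  | _, _, .un J => .un (m J)

theorem HPath.map_comp.{u, w, u', w'} {Ob : Type u} {Hor : Ob → Ob → Type w} {Ob' : Type u'}
    {Hor' : Ob' → Ob' → Type w'} (o : Ob → Ob')
    (m : ∀ {A B : Ob}, Hor A B → Hor' (o A) (o B)) {A B C : Ob}
    (P : HPath Hor A B) (Q : HPath Hor B C) :
    HPath.map o m (P.comp Q) = (HPath.map o m P).comp (HPath.map o m Q) := by
  induction P with
  | nil A => rfl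
  | cons J P ih => simp only [HPath.comp, HPath.map, ih]

theorem HTarget.map_toPath.{u, w, u', w'} {Ob : Type u} {Hor : Ob → Ob → Type w} {Ob' : Type u'}
    {Hor' : Ob' → Ob' → Type w'} (o : Ob → Ob')
    (m : ∀ {A B : Ob}, Hor A B → Hor' (o A) (o B)) {A B : Ob} (T : HTarget Hor A B) :
    HPath.map o m T.toPath = (HTarget.map o m T).toPath := by
  cases T <;> rfl

/-- Assignments on objects, vertical morphisms (functorial), horizontal morphisms and cells. -/
structure GraphHom.{u, v, w, x, u', v', w', x'} (G : Graph.{u, v, w, x})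
    (H : Graph.{u', v', w', x'}) where
  onVert : G.Obj ⥤ H.Obj
  onHor : ∀ {A B : G.Obj}, G.Hor A B → H.Hor (onVert.obj A) (onVert.obj B)
  onCell : ∀ {A B C D : G.Obj} {P : HPath G.Hor A B} {f : A ⟶ C} {g : B ⟶ D}
    {T : HTarget G.Hor C D}, G.Cell P f g T →
    H.Cell (HPath.map onVert.obj onHor P) (onVert.map f) (onVert.map g)
      (HTarget.map onVert.obj onHor T)

/-- The image of a path of cells. -/
def GraphHom.onSeq.{u, v, w, x, u', v', w', x'} {G : Graph.{u, v, w, x}}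
    {H : Graph.{u', v', w', x'}} (F : GraphHom G H) :
    ∀ {A B C D : G.Obj} {P : HPath G.Hor A B} {f : A ⟶ C} {g : B ⟶ D} {Q : HPath G.Hor C D},
      CellSeq G P f g Q →
      CellSeq H (HPath.map F.onVert.obj F.onHor P) (F.onVert.map f) (F.onVert.map g)
        (HPath.map F.onVert.obj F.onHor Q)
  | _, _, _, _, _, _, _, _, .single φ hQ =>
      .single (F.onCell φ) (by rw [hQ, HTarget.map_toPath])
  | _, _, _, _, _, _, _, _, .cons φ s hP hQ =>
      .cons (F.onCell φ) (F.onSeq s) (by rw [hP, HPath.map_comp])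
        (by rw [hQ, HPath.map_comp, HTarget.map_toPath])

end AugVirt

open AugVirt in
/-- Functors of augmented virtual double categories. -/
structure AugVDCFunctor.{u, v, w, x, u', v', w', x'} (K : AugVDC.{u, v, w, x})
    (L : AugVDC.{u', v', w', x'}) extends AugVirt.GraphHom K.toGraph L.toGraph where
  onCell_comp : ∀ {A B C D E F : K.Obj} {P : HPath K.Hor A B} {Q : HPath K.Hor C D} {f : A ⟶ C}
    {g : B ⟶ D} {h : C ⟶ E} {k : D ⟶ F} {T : HTarget K.Hor E F}
    (s : CellSeq K.toGraph P f g Q) (ψ : K.Cell Q h k T),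
    onCell (K.comp s ψ rfl rfl) =
      L.comp (toGraphHom.onSeq s) (onCell ψ) (onVert.map_comp f h).symm (onVert.map_comp g k).symm
  onCell_idH : ∀ {A B : K.Obj} (J : K.Hor A B),
    onCell (K.idH J rfl rfl) = L.idH (onHor J) (onVert.map_id A) (onVert.map_id B)
  onCell_idV : ∀ {A C : K.Obj} (f : A ⟶ C), onCell (K.idV f) = L.idV (onVert.map f)

namespace AugVDCFunctor

open AugVirt

/-- The action on objects. -/
abbrev obj.{u, v, w, x, u', v', w', x'} {K : AugVDC.{u, v, w, x}} {L : AugVDC.{u', v', w', x'}}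
    (F : AugVDCFunctor K L) (A : K.Obj) : L.Obj := F.onVert.obj A

/-- The action on vertical morphisms. -/
abbrev map.{u, v, w, x, u', v', w', x'} {K : AugVDC.{u, v, w, x}} {L : AugVDC.{u', v', w', x'}}
    (F : AugVDCFunctor K L) {A B : K.Obj} (f : A ⟶ B) : F.obj A ⟶ F.obj B := F.onVert.map f

/-- The action on paths of horizontal morphisms. -/
abbrev onPath.{u, v, w, x, u', v', w', x'} {K : AugVDC.{u, v, w, x}}
    {L : AugVDC.{u', v', w', x'}} (F : AugVDCFunctor K L) {A B : K.Obj} (P : HPath K.Hor A B) :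
    HPath L.Hor (F.obj A) (F.obj B) := HPath.map F.onVert.obj F.onHor P

end AugVDCFunctor

namespace AugVDC

open AugVirt

/-- The horizontal composite `φ ⊙ ψ = id_{id_M} ∘ (φ, ψ)` of nullary cells. -/
def hcomp.{u, v, w, x} (K : AugVDC.{u, v, w, x}) {A B C M : K.Obj} {P₁ : HPath K.Hor A B}
    {P₂ : HPath K.Hor B C} {P : HPath K.Hor A C} {f : A ⟶ M} {g : B ⟶ M} {h : C ⟶ M}
    (φ : K.Cell P₁ f g (.nul M)) (ψ : K.Cell P₂ g h (.nul M)) (hP : P = P₁.comp P₂) :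
    K.Cell P f h (.nul M) :=
  K.comp (.cons φ (.single ψ rfl) hP rfl) (K.idV (𝟙 M)) (Category.comp_id f) (Category.comp_id h)

/-- The composite `e ∘ φ = id_e ∘ φ` of a nullary cell `φ` with a vertical morphism `e`. -/
def whisker.{u, v, w, x} (K : AugVDC.{u, v, w, x}) {A B M N : K.Obj} {P : HPath K.Hor A B}
    {f : A ⟶ M} {g : B ⟶ M} (φ : K.Cell P f g (.nul M)) (e : M ⟶ N) :
    K.Cell P (f ≫ e) (g ≫ e) (.nul N) :=
  K.comp (.single φ rfl) (K.idV e) rfl rfl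

theorem insert_left'.{u, v, w, x} (K : AugVDC.{u, v, w, x}) {A B C D E F : K.Obj}
    {P : HPath K.Hor A B} {Q : HPath K.Hor C D} {f : A ⟶ C}
    {g : B ⟶ D} {h : C ⟶ E} {k : D ⟶ F} {T : HTarget K.Hor E F} {f' : A ⟶ E} {g' : B ⟶ F}
    (s : CellSeq K.toGraph P f g Q) (ψ : K.Cell Q h k T) (hf : f ≫ h = f') (hg : g ≫ k = g') :
    K.comp (.cons (K.idV f) s rfl rfl) ψ hf hg = K.comp s ψ hf hg := by
  subst hf hg
  exact K.insert_left s ψ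

theorem insert_right'.{u, v, w, x} (K : AugVDC.{u, v, w, x}) {A B C D E F : K.Obj}
    {P : HPath K.Hor A B} {Q : HPath K.Hor C D} {f : A ⟶ C}
    {g : B ⟶ D} {h : C ⟶ E} {k : D ⟶ F} {T : HTarget K.Hor E F} {f' : A ⟶ E} {g' : B ⟶ F}
    (s : CellSeq K.toGraph P f g Q) (ψ : K.Cell Q h k T) (hf : f ≫ h = f') (hg : g ≫ k = g') :
    K.comp (s.append (.single (K.idV g) rfl) (HPath.comp_nil P).symm (HPath.comp_nil Q).symm)
      ψ hf hg = K.comp s ψ hf hg := by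
  subst hf hg
  exact K.insert_right s ψ

theorem idV_comp_idV'.{u, v, w, x} (K : AugVDC.{u, v, w, x}) {A C E : K.Obj} {f : A ⟶ C}
    {h : C ⟶ E} {f' : A ⟶ E} (hf : f ≫ h = f') :
    K.comp (.single (K.idV f) rfl) (K.idV h) hf hf = K.idV f' := by
  subst hf
  exact K.idV_comp_idV f h

theorem comp_single.{u, v, w, x} (K : AugVDC.{u, v, w, x}) {A B C E D F : K.Obj}
    {P : HPath K.Hor A B} {f : A ⟶ C} {g : B ⟶ C} {e : C ⟶ E} {p : E ⟶ D} {q : E ⟶ F}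
    {T : HTarget K.Hor D F} (s : CellSeq K.toGraph P f g (.nil C)) (χ : K.Cell (.nil E) p q T)
    {f' : A ⟶ E} {g' : B ⟶ E} {p' : C ⟶ D} {q' : C ⟶ F} {f'' : A ⟶ D} {g'' : B ⟶ F}
    (hf : f ≫ e = f') (hg : g ≫ e = g') (hp : e ≫ p = p') (hq : e ≫ q = q')
    (hf₁ : f' ≫ p = f'') (hg₁ : g' ≫ q = g'') (hf₂ : f ≫ p' = f'') (hg₂ : g ≫ q' = g'') :
    K.comp (.single (K.comp s (K.idV e) hf hg) rfl) χ hf₁ hg₁ =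
      K.comp s (K.comp (.single (K.idV e) rfl) χ hp hq) hf₂ hg₂ := by
  subst hf hg hp hq hf₂ hg₂
  exact K.assoc (.single s (K.idV e) rfl) χ

theorem comp_pair.{u, v, w, x} (K : AugVDC.{u, v, w, x}) {A X B C E D F : K.Obj}
    {P₁ : HPath K.Hor A X} {P₂ : HPath K.Hor X B} {P : HPath K.Hor A B}
    {f : A ⟶ C} {m : X ⟶ C} {g : B ⟶ C} {e : C ⟶ E} {p : E ⟶ D} {q : E ⟶ F}
    {T : HTarget K.Hor D F} (s : CellSeq K.toGraph P₁ f m (.nil C))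
    (t : CellSeq K.toGraph P₂ m g (.nil C)) (χ : K.Cell (.nil E) p q T)
    {f' : A ⟶ E} {m' : X ⟶ E} {g' : B ⟶ E} {p' : C ⟶ D} {q' : C ⟶ F} {f'' : A ⟶ D} {g'' : B ⟶ F}
    (hP : P = P₁.comp P₂) (hf : f ≫ e = f') (hm : m ≫ e = m') (hg : g ≫ e = g')
    (hp : e ≫ p = p') (hq : e ≫ q = q')
    (hf₁ : f' ≫ p = f'') (hg₁ : g' ≫ q = g'') (hf₂ : f ≫ p' = f'') (hg₂ : g ≫ q' = g'') :
    K.comp (.cons (K.comp s (K.idV e) hf hm) (.single (K.comp t (K.idV e) hm hg) rfl) hP rfl) χ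
        hf₁ hg₁ =
      K.comp (s.append t hP rfl) (K.comp (.single (K.idV e) rfl) χ hp hq) hf₂ hg₂ := by
  subst hf hm hg hp hq hf₂ hg₂
  have h := K.assoc (.cons s (K.idV e) (.single t (K.idV e) rfl) hP rfl rfl) χ
  refine h.trans ?_
  exact congrArg (fun c => K.comp (s.append t hP rfl) c rfl rfl)
    (K.insert_left (.single (K.idV e) rfl) χ)

theorem idV_hcomp.{u, v, w, x} (K : AugVDC.{u, v, w, x}) {A B M : K.Obj} {P : HPath K.Hor A B}
    {f : A ⟶ M} {g : B ⟶ M} (φ : K.Cell P f g (.nul M)) :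
    K.hcomp (K.idV f) φ (P := P) rfl = φ :=
  (K.insert_left' (.single φ rfl) (K.idV (𝟙 M)) _ _).trans (K.idV_comp φ)

theorem hcomp_idV.{u, v, w, x} (K : AugVDC.{u, v, w, x}) {A B M : K.Obj} {P : HPath K.Hor A B}
    {f : A ⟶ M} {g : B ⟶ M} (φ : K.Cell P f g (.nul M)) :
    K.hcomp φ (K.idV g) (HPath.comp_nil P).symm = φ :=
  (K.insert_right' (.single φ rfl) (K.idV (𝟙 M)) _ _).trans (K.idV_comp φ)

theorem hcomp_assoc.{u, v, w, x} (K : AugVDC.{u, v, w, x}) {A B C D M : K.Obj}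
    {P₁ : HPath K.Hor A B} {P₂ : HPath K.Hor B C} {P₃ : HPath K.Hor C D}
    {P₁₂ : HPath K.Hor A C} {P₂₃ : HPath K.Hor B D} {P : HPath K.Hor A D}
    {f : A ⟶ M} {g : B ⟶ M} {h : C ⟶ M} {k : D ⟶ M}
    (φ : K.Cell P₁ f g (.nul M)) (ψ : K.Cell P₂ g h (.nul M)) (ξ : K.Cell P₃ h k (.nul M))
    (h₁₂ : P₁₂ = P₁.comp P₂) (h₂₃ : P₂₃ = P₂.comp P₃) (hl : P = P₁₂.comp P₃)
    (hr : P = P₁.comp P₂₃) :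
    K.hcomp (K.hcomp φ ψ h₁₂) ξ hl = K.hcomp φ (K.hcomp ψ ξ h₂₃) hr := by
  have hξ := K.idV_comp ξ
  have hφ := K.idV_comp φ
  have h1 := K.comp_pair (.cons φ (.single ψ rfl) h₁₂ rfl) (.single ξ rfl) (K.idV (𝟙 M)) hl
    (Category.comp_id f) (Category.comp_id h) (Category.comp_id k) (Category.comp_id _)
    (Category.comp_id _) (Category.comp_id f) (Category.comp_id k) (Category.comp_id f)
    (Category.comp_id k)
  have h2 := K.comp_pair (.single φ rfl) (.cons ψ (.single ξ rfl) h₂₃ rfl) (K.idV (𝟙 M)) hr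
    (Category.comp_id f) (Category.comp_id g) (Category.comp_id k) (Category.comp_id _)
    (Category.comp_id _) (Category.comp_id f) (Category.comp_id k) (Category.comp_id f)
    (Category.comp_id k)
  have hl' : K.hcomp (K.hcomp φ ψ h₁₂) ξ hl = K.hcomp (K.hcomp φ ψ h₁₂)
      (K.comp (.single ξ rfl) (K.idV (𝟙 M)) (Category.comp_id h) (Category.comp_id k)) hl :=
    congrArg (fun c => K.hcomp (K.hcomp φ ψ h₁₂) c hl) hξ.symm
  have hr' : K.hcomp φ (K.hcomp ψ ξ h₂₃) hr = K.hcomp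
      (K.comp (.single φ rfl) (K.idV (𝟙 M)) (Category.comp_id f) (Category.comp_id g))
      (K.hcomp ψ ξ h₂₃) hr :=
    congrArg (fun c => K.hcomp c (K.hcomp ψ ξ h₂₃) hr) hφ.symm
  subst h₂₃
  exact hl'.trans (h1.trans (h2.symm.trans hr'.symm))

theorem whisker_idV.{u, v, w, x} (K : AugVDC.{u, v, w, x}) {A M N : K.Obj} (f : A ⟶ M)
    (e : M ⟶ N) : K.whisker (K.idV f) e = K.idV (f ≫ e) :=
  K.idV_comp_idV f e

theorem whisker_hcomp.{u, v, w, x} (K : AugVDC.{u, v, w, x}) {A B C M N : K.Obj}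
    {P₁ : HPath K.Hor A B} {P₂ : HPath K.Hor B C} {P : HPath K.Hor A C}
    {f : A ⟶ M} {g : B ⟶ M} {h : C ⟶ M}
    (φ : K.Cell P₁ f g (.nul M)) (ψ : K.Cell P₂ g h (.nul M)) (hP : P = P₁.comp P₂) (e : M ⟶ N) :
    K.whisker (K.hcomp φ ψ hP) e = K.hcomp (K.whisker φ e) (K.whisker ψ e) hP := by
  have h1 := K.comp_single (.cons φ (.single ψ rfl) hP rfl) (K.idV e)
    (Category.comp_id f) (Category.comp_id h) (Category.id_comp e) (Category.id_comp e)
    rfl rfl rfl rfl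
  have h2 := K.comp_pair (.single φ rfl) (.single ψ rfl) (K.idV (𝟙 N)) hP
    (f := f) (m := g) (g := h) (e := e) rfl rfl rfl (Category.comp_id e)
    (Category.comp_id e) (Category.comp_id (f ≫ e)) (Category.comp_id (h ≫ e)) rfl rfl
  have h3 := congrArg
    (fun c => K.comp (.cons φ (.single ψ rfl) hP rfl) c (f' := f ≫ e) (g' := h ≫ e) rfl rfl)
    (K.idV_comp_idV' (Category.id_comp e))
  have h4 := congrArg
    (fun c => K.comp (.cons φ (.single ψ rfl) hP rfl) c (f' := f ≫ e) (g' := h ≫ e) rfl rfl)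
    (K.idV_comp_idV' (Category.comp_id e))
  exact (h1.trans h3).trans (h2.trans h4).symm

/-- Objects of the category `K / X`: vertical morphisms with target `X`. -/
structure Slice.{u, v, w, x} (K : AugVDC.{u, v, w, x}) (X : K.Obj) where
  base : K.Obj
  hom : base ⟶ X

/-- Morphisms of `K / X` from `f : A ⟶ X` to `g : C ⟶ X`: pairs consisting of a path `A ⇸ C` and a
nullary cell with that path as horizontal source, and with vertical boundary `f`, `g`. -/
structure Slice.Hom.{u, v, w, x} {K : AugVDC.{u, v, w, x}} {X : K.Obj} (f g : K.Slice X) where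
  path : HPath K.Hor f.base g.base
  cell : K.Cell path f.hom g.hom (.nul X)

theorem Slice.Hom.mk_hcomp.{u, v, w, x} {K : AugVDC.{u, v, w, x}} {X : K.Obj} {f g h : K.Slice X}
    {P₁ : HPath K.Hor f.base g.base} {P₂ : HPath K.Hor g.base h.base}
    {P : HPath K.Hor f.base h.base} (φ : K.Cell P₁ f.hom g.hom (.nul X))
    (ψ : K.Cell P₂ g.hom h.hom (.nul X)) (hP : P = P₁.comp P₂) :
    (⟨P₁.comp P₂, K.hcomp φ ψ rfl⟩ : Slice.Hom f h) = ⟨P, K.hcomp φ ψ hP⟩ := by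
  subst hP
  rfl

instance Slice.category.{u, v, w, x} {K : AugVDC.{u, v, w, x}} (X : K.Obj) :
    Category (K.Slice X) where
  Hom f g := Slice.Hom f g
  id f := ⟨.nil f.base, K.idV f.hom⟩
  comp φ ψ := ⟨φ.path.comp ψ.path, K.hcomp φ.cell ψ.cell rfl⟩
  id_comp φ := congrArg (Slice.Hom.mk φ.path) (K.idV_hcomp φ.cell)
  comp_id φ := (Slice.Hom.mk_hcomp _ _ (HPath.comp_nil φ.path).symm).trans
    (congrArg (Slice.Hom.mk φ.path) (K.hcomp_idV φ.cell))
  assoc φ ψ ξ := (Slice.Hom.mk_hcomp (K.hcomp φ.cell ψ.cell rfl) ξ.cell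
      (HPath.comp_assoc φ.path ψ.path ξ.path).symm).trans
    (congrArg (Slice.Hom.mk _) (K.hcomp_assoc φ.cell ψ.cell ξ.cell rfl rfl _ rfl))

end AugVDC

namespace AugVDCFunctor

open AugVirt

/-- Objects of the category `F / X`: pairs of an object `A` and a vertical morphism
`F A ⟶ X`. -/
structure Slice.{u, v, w, x, u', v', w', x'} {K : AugVDC.{u, v, w, x}}
    {L : AugVDC.{u', v', w', x'}} (F : AugVDCFunctor K L) (X : L.Obj) where
  base : K.Obj
  hom : F.obj base ⟶ X

/-- Morphisms of `F / X` from `(A, f)` to `(C, g)`: pairs consisting of a path `H : A ⇸ C` and a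
nullary cell with horizontal source `F H`, and with vertical boundary `f`, `g`. -/
structure Slice.Hom.{u, v, w, x, u', v', w', x'} {K : AugVDC.{u, v, w, x}}
    {L : AugVDC.{u', v', w', x'}} {F : AugVDCFunctor K L} {X : L.Obj} (f g : F.Slice X) where
  path : HPath K.Hor f.base g.base
  cell : L.Cell (F.onPath path) f.hom g.hom (.nul X)

theorem Slice.Hom.mk_hcomp.{u, v, w, x, u', v', w', x'} {K : AugVDC.{u, v, w, x}}
    {L : AugVDC.{u', v', w', x'}} {F : AugVDCFunctor K L} {X : L.Obj} {f g h : F.Slice X}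
    {P₁ : HPath K.Hor f.base g.base} {P₂ : HPath K.Hor g.base h.base}
    {P : HPath K.Hor f.base h.base} (φ : L.Cell (F.onPath P₁) f.hom g.hom (.nul X))
    (ψ : L.Cell (F.onPath P₂) g.hom h.hom (.nul X)) (hP : P = P₁.comp P₂) :
    (⟨P₁.comp P₂, L.hcomp φ ψ (HPath.map_comp _ _ _ _)⟩ : Slice.Hom f h) =
      ⟨P, L.hcomp φ ψ ((congrArg F.onPath hP).trans (HPath.map_comp _ _ _ _))⟩ := by
  subst hP
  rfl

instance Slice.category.{u, v, w, x, u', v', w', x'} {K : AugVDC.{u, v, w, x}}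
    {L : AugVDC.{u', v', w', x'}} {F : AugVDCFunctor K L} (X : L.Obj) :
    Category (F.Slice X) where
  Hom f g := Slice.Hom f g
  id f := ⟨.nil f.base, L.idV f.hom⟩
  comp φ ψ := ⟨φ.path.comp ψ.path, L.hcomp φ.cell ψ.cell (HPath.map_comp _ _ _ _)⟩
  id_comp φ := congrArg (Slice.Hom.mk φ.path) (L.idV_hcomp φ.cell)
  comp_id φ := (Slice.Hom.mk_hcomp _ _ (HPath.comp_nil φ.path).symm).trans
    (congrArg (Slice.Hom.mk φ.path) (L.hcomp_idV φ.cell))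
  assoc φ ψ ξ := (Slice.Hom.mk_hcomp (L.hcomp φ.cell ψ.cell (HPath.map_comp _ _ _ _)) ξ.cell
      (HPath.comp_assoc φ.path ψ.path ξ.path).symm).trans
    (congrArg (Slice.Hom.mk _) (L.hcomp_assoc φ.cell ψ.cell ξ.cell _ _ _ _))

theorem onCell_comp'.{u, v, w, x, u', v', w', x'} {K : AugVDC.{u, v, w, x}}
    {L : AugVDC.{u', v', w', x'}} (F : AugVDCFunctor K L) {A B C D E E' : K.Obj}
    {P : HPath K.Hor A B} {Q : HPath K.Hor C D} {f : A ⟶ C}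
    {g : B ⟶ D} {h : C ⟶ E} {k : D ⟶ E'} {T : HTarget K.Hor E E'} {f' : A ⟶ E} {g' : B ⟶ E'}
    (s : CellSeq K.toGraph P f g Q) (ψ : K.Cell Q h k T) (hf : f ≫ h = f') (hg : g ≫ k = g')
    (hf' : F.map f ≫ F.map h = F.map f') (hg' : F.map g ≫ F.map k = F.map g') :
    F.onCell (K.comp s ψ hf hg) = L.comp (F.onSeq s) (F.onCell ψ) hf' hg' := by
  subst hf hg
  exact F.onCell_comp s ψ

theorem onCell_hcomp.{u, v, w, x, u', v', w', x'} {K : AugVDC.{u, v, w, x}}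
    {L : AugVDC.{u', v', w', x'}} (F : AugVDCFunctor K L) {A B C M : K.Obj}
    {P₁ : HPath K.Hor A B} {P₂ : HPath K.Hor B C} {P : HPath K.Hor A C}
    {f : A ⟶ M} {g : B ⟶ M} {h : C ⟶ M}
    (φ : K.Cell P₁ f g (.nul M)) (ψ : K.Cell P₂ g h (.nul M)) (hP : P = P₁.comp P₂) :
    F.onCell (K.hcomp φ ψ hP) = L.hcomp (F.onCell φ) (F.onCell ψ)
      ((congrArg F.onPath hP).trans (HPath.map_comp _ _ _ _)) := by
  have key : ∀ {e : F.obj M ⟶ F.obj M} (he : e = 𝟙 (F.obj M)) (hf : F.map f ≫ e = F.map f)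
      (hh : F.map h ≫ e = F.map h),
      L.comp (F.onSeq (.cons φ (.single ψ rfl) hP rfl)) (L.idV e) hf hh =
        L.hcomp (F.onCell φ) (F.onCell ψ)
          ((congrArg F.onPath hP).trans (HPath.map_comp _ _ _ _)) := by
    intro e he hf hh
    subst he
    rfl
  have hid := F.onVert.map_id M
  have hf : F.map f ≫ F.map (𝟙 M) = F.map f :=
    (F.onVert.map_comp f (𝟙 M)).symm.trans (congrArg F.map (Category.comp_id f))
  have hh : F.map h ≫ F.map (𝟙 M) = F.map h :=
    (F.onVert.map_comp h (𝟙 M)).symm.trans (congrArg F.map (Category.comp_id h))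
  have h1 := F.onCell_comp' (.cons φ (.single ψ rfl) hP rfl) (K.idV (𝟙 M))
    (Category.comp_id f) (Category.comp_id h) hf hh
  have h2 := congrArg
    (fun c => L.comp (F.onSeq (.cons φ (.single ψ rfl) hP rfl)) c hf hh) (F.onCell_idV (𝟙 M))
  exact (h1.trans h2).trans (key hid hf hh)

/-- The functor `ε ∘ F- : K / C' ⥤ F / C`. -/
def sliceFunctor.{u, v, w, x, u', v', w', x'} {K : AugVDC.{u, v, w, x}}
    {L : AugVDC.{u', v', w', x'}} (F : AugVDCFunctor K L) {C' : K.Obj} {C : L.Obj}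
    (ε : F.obj C' ⟶ C) : K.Slice C' ⥤ F.Slice C where
  obj f := ⟨f.base, F.map f.hom ≫ ε⟩
  map φ := ⟨φ.path, L.whisker (F.onCell φ.cell) ε⟩
  map_id f := congrArg
    (fun c => (⟨.nil f.base, c⟩ : Slice.Hom (F := F) (X := C) ⟨_, _⟩ ⟨_, _⟩))
    ((congrArg (fun c => L.whisker c ε) (F.onCell_idV f.hom)).trans
      (L.whisker_idV (F.map f.hom) ε))
  map_comp φ ψ := congrArg
    (fun c => (⟨φ.path.comp ψ.path, c⟩ : Slice.Hom (F := F) (X := C) ⟨_, _⟩ ⟨_, _⟩))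
    ((congrArg (fun c => L.whisker c ε) (F.onCell_hcomp φ.cell ψ.cell rfl)).trans
      (L.whisker_hcomp (F.onCell φ.cell) (F.onCell ψ.cell) (HPath.map_comp _ _ _ _) ε))

end AugVDCFunctor

namespace AugVDC

open AugVirt

/-- A cell `ψ` with horizontal source of length at most one is cartesian if every cell with the same
horizontal target whose vertical boundary factors through that of `ψ` factors uniquely
through `ψ`. -/
def IsCartesian.{u, v, w, x} (K : AugVDC.{u, v, w, x}) {A B C D : K.Obj} {S : HTarget K.Hor A B}
    {f : A ⟶ C} {g : B ⟶ D} {T : HTarget K.Hor C D} (ψ : K.Cell S.toPath f g T) : Prop :=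
  ∀ {X Y : K.Obj} (P : HPath K.Hor X Y) (h : X ⟶ A) (k : Y ⟶ B) (χ : K.Cell P (h ≫ f) (k ≫ g) T),
    ∃! φ : K.Cell P h k S, K.comp (.single φ rfl) ψ rfl rfl = χ

/-- A cartesian cell defining the horizontal morphism `J` as the restriction of the horizontal
target `T` along `f` and `g`. The restriction is unary if `T` is a horizontal morphism and nullary
if `T` is empty. -/
structure Restriction.{u, v, w, x} (K : AugVDC.{u, v, w, x}) {A B C D : K.Obj}
    (T : HTarget K.Hor C D) (f : A ⟶ C) (g : B ⟶ D) (J : K.Hor A B) where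
  cell : K.Cell (.of J) f g T
  cartesian : K.IsCartesian (S := .un J) cell

/-- The restriction of `T` along `f` and `g` exists. -/
def HasRestriction.{u, v, w, x} (K : AugVDC.{u, v, w, x}) {A B C D : K.Obj}
    (T : HTarget K.Hor C D) (f : A ⟶ C) (g : B ⟶ D) : Prop :=
  ∃ J : K.Hor A B, Nonempty (K.Restriction T f g J)

/-- An object `A` is unital if it admits a horizontal unit, that is the nullary restriction
`A(id, id)`. -/
def IsUnital.{u, v, w, x} (K : AugVDC.{u, v, w, x}) (A : K.Obj) : Prop :=
  K.HasRestriction (.nul A) (𝟙 A) (𝟙 A)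

/-- Cartesian cells defining `J` as the companion of `f`, that is the nullary restriction
`C(f, id)`. -/
abbrev Companion.{u, v, w, x} (K : AugVDC.{u, v, w, x}) {A C : K.Obj} (f : A ⟶ C)
    (J : K.Hor A C) := K.Restriction (.nul C) f (𝟙 C) J

/-- A vertical morphism is full and faithful if its identity cell is cartesian. -/
def IsFullyFaithful.{u, v, w, x} (K : AugVDC.{u, v, w, x}) {A C : K.Obj} (f : A ⟶ C) : Prop :=
  K.IsCartesian (S := .nul A) (K.idV f)

/-- A nullary cell `η` with horizontal source `P` and vertical boundary `d`, `l` is left Kan, that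
is it defines `l` as the left Kan extension of `d` along `P`. -/
def IsLeftKan.{u, v, w, x} (K : AugVDC.{u, v, w, x}) {A B M : K.Obj} {P : HPath K.Hor A B}
    {d : A ⟶ M} {l : B ⟶ M} (η : K.Cell P d l (.nul M)) : Prop :=
  ∀ {C : K.Obj} (H : HPath K.Hor B C) (k : C ⟶ M) (φ : K.Cell (P.comp H) d k (.nul M)),
    ∃! φ' : K.Cell H l k (.nul M), K.hcomp η φ' rfl = φ

/-- A vertical morphism `f : A ⟶ M` is dense if every cartesian nullary cell with vertical source
`f` and horizontal source a single horizontal morphism is left Kan. -/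
def IsDense.{u, v, w, x} (K : AugVDC.{u, v, w, x}) {A M : K.Obj} (f : A ⟶ M) : Prop :=
  ∀ {B : K.Obj} (J : K.Hor A B) (l : B ⟶ M) (η : K.Restriction (.nul M) f l J),
    K.IsLeftKan η.cell

/-- The Yoneda axiom: every `J : A ⇸ B` is the nullary restriction of `M` along `y` and some
vertical morphism `B ⟶ M`. -/
def YonedaAxiom.{u, v, w, x} (K : AugVDC.{u, v, w, x}) {A M : K.Obj} (y : A ⟶ M) : Prop :=
  ∀ {B : K.Obj} (J : K.Hor A B), ∃ l : B ⟶ M, Nonempty (K.Restriction (.nul M) y l J)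

/-- Yoneda morphisms: dense morphisms satisfying the Yoneda axiom. -/
structure IsYonedaMorphism.{u, v, w, x} (K : AugVDC.{u, v, w, x}) {A M : K.Obj}
    (y : A ⟶ M) : Prop where
  dense : K.IsDense y
  yoneda : K.YonedaAxiom y

/-- Yoneda embeddings: full and faithful Yoneda morphisms. -/
structure IsYonedaEmbedding.{u, v, w, x} (K : AugVDC.{u, v, w, x}) {A M : K.Obj}
    (y : A ⟶ M) : Prop extends K.IsYonedaMorphism y where
  fullyFaithful : K.IsFullyFaithful y

/-- Vertical isomorphisms `f ≅ g`: vertical cells `f ⇒ g` that are invertible with respect to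
horizontal composition. -/
structure VertIso.{u, v, w, x} (K : AugVDC.{u, v, w, x}) {A M : K.Obj} (f g : A ⟶ M) where
  hom : K.Cell (.nil A) f g (.nul M)
  inv : K.Cell (.nil A) g f (.nul M)
  hom_inv : K.hcomp hom inv rfl = K.idV f
  inv_hom : K.hcomp inv hom rfl = K.idV g

/-- A path of cells is weakly nullary-cocartesian if every nullary cell, with the same horizontal
source and whose vertical boundary factors through that of the path, factors uniquely
through the path. -/
def IsWeaklyNullaryCocartesian.{u, v, w, x} (K : AugVDC.{u, v, w, x}) {A B C D : K.Obj}
    {P : HPath K.Hor A B} {f : A ⟶ C} {g : B ⟶ D} {Q : HPath K.Hor C D}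
    (s : CellSeq K.toGraph P f g Q) : Prop :=
  ∀ {E : K.Obj} (h : C ⟶ E) (k : D ⟶ E) (χ : K.Cell P (f ≫ h) (g ≫ k) (.nul E)),
    ∃! χ' : K.Cell Q h k (.nul E), K.comp s χ' rfl rfl = χ

/-- The variant of `IsWeaklyNullaryCocartesian` for unary cells. -/
def IsWeaklyUnaryCocartesian.{u, v, w, x} (K : AugVDC.{u, v, w, x}) {A B C D : K.Obj}
    {P : HPath K.Hor A B} {f : A ⟶ C} {g : B ⟶ D} {Q : HPath K.Hor C D}
    (s : CellSeq K.toGraph P f g Q) : Prop :=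
  ∀ {E F : K.Obj} (h : C ⟶ E) (k : D ⟶ F) (L : K.Hor E F)
    (χ : K.Cell P (f ≫ h) (g ≫ k) (.un L)),
    ∃! χ' : K.Cell Q h k (.un L), K.comp s χ' rfl rfl = χ

/-- A path of cells `s`, with last vertical boundary `g`, is right nullary-cocartesian if it is
weakly nullary-cocartesian and, for every path `(K₁, …, K_q)` with `q ≥ 1` and every cartesian cell
defining `K₁(g, id)`, so is the concatenation of `s` with `(cart, id_{K₂}, …, id_{K_q})`. (For
`q = 1` the path of identity cells consists of a vertical identity cell, which is neutral.) -/
def IsRightNullaryCocartesian.{u, v, w, x} (K : AugVDC.{u, v, w, x}) {A B C D : K.Obj}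
    {P : HPath K.Hor A B} {f : A ⟶ C} {g : B ⟶ D} {Q : HPath K.Hor C D}
    (s : CellSeq K.toGraph P f g Q) : Prop :=
  K.IsWeaklyNullaryCocartesian s ∧
    ∀ {Y Z : K.Obj} (K₁ : K.Hor D Y) (R : HPath K.Hor Y Z) (K₁' : K.Hor B Y)
      (c : K.Restriction (.un K₁) g (𝟙 Y) K₁'),
      K.IsWeaklyNullaryCocartesian (s.append (.cons c.cell (K.idSeq R) rfl rfl) rfl rfl)

/-- The unary variant of `IsRightNullaryCocartesian`. -/
def IsRightUnaryCocartesian.{u, v, w, x} (K : AugVDC.{u, v, w, x}) {A B C D : K.Obj}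
    {P : HPath K.Hor A B} {f : A ⟶ C} {g : B ⟶ D} {Q : HPath K.Hor C D}
    (s : CellSeq K.toGraph P f g Q) : Prop :=
  K.IsWeaklyUnaryCocartesian s ∧
    ∀ {Y Z : K.Obj} (K₁ : K.Hor D Y) (R : HPath K.Hor Y Z) (K₁' : K.Hor B Y)
      (c : K.Restriction (.un K₁) g (𝟙 Y) K₁'),
      K.IsWeaklyUnaryCocartesian (s.append (.cons c.cell (K.idSeq R) rfl rfl) rfl rfl)

/-- A cell is right cocartesian if it is both right nullary-cocartesian and right
unary-cocartesian. -/
def IsRightCocartesian.{u, v, w, x} (K : AugVDC.{u, v, w, x}) {A B C D : K.Obj}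
    {P : HPath K.Hor A B} {f : A ⟶ C} {g : B ⟶ D} {T : HTarget K.Hor C D}
    (φ : K.Cell P f g T) : Prop :=
  K.IsRightNullaryCocartesian (.single φ rfl) ∧ K.IsRightUnaryCocartesian (.single φ rfl)

/-- A horizontal cell `φ : (P₁, …, P_m, H) ⇒ J` is pointwise right cocartesian if it is right
cocartesian and, for every `f : Y ⟶ B` and every cartesian cell `c` defining a restriction
`H(id, f)`, the restriction `J(id, f)` exists and the unique factorisation `φ'` of
`φ ∘ (id_{P₁}, …, id_{P_m}, c)` through a cartesian cell defining `J(id, f)` is again right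
cocartesian. -/
def IsPointwiseRightCocartesian.{u, v, w, x} (K : AugVDC.{u, v, w, x}) {A X B : K.Obj}
    {P : HPath K.Hor A X} {H : K.Hor X B} {J : K.Hor A B}
    (φ : K.Cell (P.comp (.of H)) (𝟙 A) (𝟙 B) (.un J)) : Prop :=
  K.IsRightCocartesian φ ∧
    ∀ {Y : K.Obj} (f : Y ⟶ B) (H' : K.Hor X Y) (c : K.Restriction (.un H) (𝟙 X) f H'),
      K.HasRestriction (.un J) (𝟙 A) f ∧
      ∀ (J' : K.Hor A Y) (e : K.Restriction (.un J) (𝟙 A) f J')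
        (φ' : K.Cell (P.comp (.of H')) (𝟙 A) (𝟙 Y) (.un J')),
        K.comp (.single φ' rfl) e.cell (Category.comp_id (𝟙 A)) (Category.id_comp f) =
          K.comp ((K.idSeq P).append (.single c.cell rfl) rfl rfl) φ
            (Category.comp_id (𝟙 A)) (Category.comp_id f) →
        K.IsRightCocartesian φ'

/-- Pointwise right cocartesian cells exhibiting `J` as the pointwise right composite of the
path `(H₁, H₂)`. -/
structure RightComposite.{u, v, w, x} (K : AugVDC.{u, v, w, x}) {A X B : K.Obj}
    (H₁ : K.Hor A X) (H₂ : K.Hor X B) (J : K.Hor A B) where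
  cell : K.Cell ((HPath.of H₁).comp (.of H₂)) (𝟙 A) (𝟙 B) (.un J)
  cocartesian : K.IsPointwiseRightCocartesian cell

end AugVDC

namespace AugVDCFunctor

open AugVirt

/-- `F` preserves the restriction of the horizontal morphism `J` along `f` and `g`: the image of any
cartesian cell defining it is cartesian. -/
def PreservesRestriction.{u, v, w, x, u', v', w', x'} {K : AugVDC.{u, v, w, x}}
    {L : AugVDC.{u', v', w', x'}} (F : AugVDCFunctor K L) {A B C D : K.Obj} (J : K.Hor C D)
    (f : A ⟶ C) (g : B ⟶ D) : Prop :=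
  ∀ (H : K.Hor A B) (c : K.Restriction (.un J) f g H),
    L.IsCartesian (S := .un (F.onHor H)) (F.onCell c.cell)

/-- `ε : F C' ⟶ C` is locally universal from `F` to `C`. -/
def IsLocallyUniversal.{u, v, w, x, u', v', w', x'} {K : AugVDC.{u, v, w, x}}
    {L : AugVDC.{u', v', w', x'}} (F : AugVDCFunctor K L) {C' : K.Obj} {C : L.Obj}
    (ε : F.obj C' ⟶ C) : Prop :=
  (F.sliceFunctor ε).Full ∧ (F.sliceFunctor ε).Faithful

/-- `ε : F C' ⟶ C` is universal from `F` to `C` relative to the full subcategory of `F / C`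
generated by the objects satisfying `𝒥`: it is locally universal, and `ε ∘ F-` factors through the
full subcategory as an equivalence. -/
def IsUniversalRelative.{u, v, w, x, u', v', w', x'} {K : AugVDC.{u, v, w, x}}
    {L : AugVDC.{u', v', w', x'}} (F : AugVDCFunctor K L) {C' : K.Obj} {C : L.Obj}
    (ε : F.obj C' ⟶ C) (𝒥 : ObjectProperty (F.Slice C)) : Prop :=
  F.IsLocallyUniversal ε ∧
    ∃ h : ∀ f : K.Slice C', 𝒥 ((F.sliceFunctor ε).obj f),
      (𝒥.lift (F.sliceFunctor ε) h).IsEquivalence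

/-- For every `J : A' ⇸ B` the pointwise right composite of `(ι, F J)` exists. -/
def HasAdjuncts.{u, v, w, x, u', v', w', x'} {K : AugVDC.{u, v, w, x}}
    {L : AugVDC.{u', v', w', x'}} (F : AugVDCFunctor K L) {A : L.Obj} {A' : K.Obj}
    (ι : L.Hor A (F.obj A')) : Prop :=
  ∀ {B : K.Obj} (J : K.Hor A' B),
    ∃ Jflat : L.Hor A (F.obj B), Nonempty (L.RightComposite ι (F.onHor J) Jflat)

/-- For every `h : X ⟶ A'` the restriction `ι(id, F h)` exists. -/
def HasRightRestrictions.{u, v, w, x, u', v', w', x'} {K : AugVDC.{u, v, w, x}}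
    {L : AugVDC.{u', v', w', x'}} (F : AugVDCFunctor K L) {A : L.Obj} {A' : K.Obj}
    (ι : L.Hor A (F.obj A')) : Prop :=
  ∀ {X : K.Obj} (h : X ⟶ A'), L.HasRestriction (.un ι) (𝟙 A) (F.map h)

/-- The assignment `φ ↦ cocart ∘ (cart, F φ)`, where `cart` defines `ι(id, F h)` and `cocart` defines
the pointwise right composite of `(ι, F J)`, from cells `P ⇒ J` of `K` with vertical boundary
`h`, `k` to cells of `L` with vertical boundary `id`, `F k`. -/
def transpose.{u, v, w, x, u', v', w', x'} {K : AugVDC.{u, v, w, x}}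
    {L : AugVDC.{u', v', w', x'}} (F : AugVDCFunctor K L) {A : L.Obj} {A' : K.Obj}
    {ι : L.Hor A (F.obj A')} {B : K.Obj} {J : K.Hor A' B} {Jflat : L.Hor A (F.obj B)}
    (cocart : L.RightComposite ι (F.onHor J) Jflat) {X Y : K.Obj} {h : X ⟶ A'}
    {ιh : L.Hor A (F.obj X)} (cart : L.Restriction (.un ι) (𝟙 A) (F.map h) ιh)
    {P : HPath K.Hor X Y} {k : Y ⟶ B} (φ : K.Cell P h k (.un J)) :
    L.Cell ((HPath.of ιh).comp (F.onPath P)) (𝟙 A) (F.map k) (.un Jflat) :=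
  L.comp (.cons cart.cell (.single (F.onCell φ) rfl) rfl rfl) cocart.cell
    (Category.comp_id (𝟙 A)) (Category.comp_id (F.map k))

/-- `ι : A ⇸ F A'` is locally universal from `A` to `F`. -/
structure IsLocallyUniversalHor.{u, v, w, x, u', v', w', x'} {K : AugVDC.{u, v, w, x}}
    {L : AugVDC.{u', v', w', x'}} (F : AugVDCFunctor K L) {A : L.Obj} {A' : K.Obj}
    (ι : L.Hor A (F.obj A')) : Prop where
  hasAdjuncts : F.HasAdjuncts ι
  hasRightRestrictions : F.HasRightRestrictions ι
  bijective : ∀ {B : K.Obj} (J : K.Hor A' B) (Jflat : L.Hor A (F.obj B))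
    (cocart : L.RightComposite ι (F.onHor J) Jflat) {X Y : K.Obj} (h : X ⟶ A')
    (ιh : L.Hor A (F.obj X)) (cart : L.Restriction (.un ι) (𝟙 A) (F.map h) ιh)
    (P : HPath K.Hor X Y) (k : Y ⟶ B),
    Function.Bijective fun φ : K.Cell P h k (.un J) => F.transpose cocart cart φ

/-- The `ι`-small morphisms: those `f : F B ⟶ M` that are the left Kan extension of `y` along the
pointwise right composite of `(ι, F J)`, for some `J : A' ⇸ B`. -/
def IsSmall.{u, v, w, x, u', v', w', x'} {K : AugVDC.{u, v, w, x}}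
    {L : AugVDC.{u', v', w', x'}} (F : AugVDCFunctor K L) {A M : L.Obj} {A' : K.Obj}
    (ι : L.Hor A (F.obj A')) (y : A ⟶ M) : ObjectProperty (F.Slice M) :=
  fun f => ∃ (J : K.Hor A' f.base) (Jflat : L.Hor A (F.obj f.base)),
    Nonempty (L.RightComposite ι (F.onHor J) Jflat) ∧
      ∃ η : L.Cell (.of Jflat) y f.hom (.nul M), L.IsLeftKan η

/-- The choices made in constructing, from a Yoneda morphism `y : A ⟶ M` in `L`, a horizontal
morphism `ι : A ⇸ F A'` and a morphism `ε : F M' ⟶ M`, the morphism `y' : A' ⟶ M'`. -/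
structure YonedaChoice.{u, v, w, x, u', v', w', x'} {K : AugVDC.{u, v, w, x}}
    {L : AugVDC.{u', v', w', x'}} (F : AugVDCFunctor K L) {A M : L.Obj} {A' M' : K.Obj}
    (ι : L.Hor A (F.obj A')) (y : A ⟶ M) (ε : F.obj M' ⟶ M) where
  /-- The adjunct of `J`. -/
  flat : ∀ {B : K.Obj}, K.Hor A' B → L.Hor A (F.obj B)
  cocart : ∀ {B : K.Obj} (J : K.Hor A' B), L.RightComposite ι (F.onHor J) (flat J)
  /-- The morphism supplied by the Yoneda axiom for `ι`. -/
  lamι : F.obj A' ⟶ M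
  cartι : L.Restriction (.nul M) y lamι ι
  /-- The morphism supplied by the Yoneda axiom for `flat J`. -/
  lam : ∀ {B : K.Obj}, K.Hor A' B → (F.obj B ⟶ M)
  cart : ∀ {B : K.Obj} (J : K.Hor A' B), L.Restriction (.nul M) y (lam J) (flat J)
  /-- The chosen adjunct of `lamι`. -/
  y' : A' ⟶ M'
  isoι : L.VertIso lamι (F.map y' ≫ ε)
  /-- The chosen adjunct of `lam J`. -/
  lam' : ∀ {B : K.Obj}, K.Hor A' B → (B ⟶ M')
  iso : ∀ {B : K.Obj} (J : K.Hor A' B), L.VertIso (F.map (lam' J) ≫ ε) (lam J)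

namespace YonedaChoice

/-- `χ` is the unique factorisation of the composite of the cells `cocart` and `cart` for `J` through
the cartesian cell defining `lamι`. -/
def IsChi.{u, v, w, x, u', v', w', x'} {K : AugVDC.{u, v, w, x}}
    {L : AugVDC.{u', v', w', x'}} {F : AugVDCFunctor K L} {A M : L.Obj} {A' M' : K.Obj}
    {ι : L.Hor A (F.obj A')} {y : A ⟶ M} {ε : F.obj M' ⟶ M} (c : F.YonedaChoice ι y ε)
    {B : K.Obj} (J : K.Hor A' B) (χ : L.Cell (.of (F.onHor J)) c.lamι (c.lam J) (.nul M)) : Prop :=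
  L.comp (.single (c.cocart J).cell rfl) (c.cart J).cell (Category.id_comp y)
    (Category.id_comp (c.lam J)) = L.hcomp c.cartι.cell χ rfl

/-- `χ'` is the adjunct of the cell `χ` associated to `J`: the latter is equal to the horizontal
composite of `ε ∘ F χ'` with the chosen vertical isomorphisms. -/
def IsChiSharp.{u, v, w, x, u', v', w', x'} {K : AugVDC.{u, v, w, x}}
    {L : AugVDC.{u', v', w', x'}} {F : AugVDCFunctor K L} {A M : L.Obj} {A' M' : K.Obj}
    {ι : L.Hor A (F.obj A')} {y : A ⟶ M} {ε : F.obj M' ⟶ M} (c : F.YonedaChoice ι y ε)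
    {B : K.Obj} (J : K.Hor A' B) (χ' : K.Cell (.of J) c.y' (c.lam' J) (.nul M')) : Prop :=
  ∃ χ : L.Cell (.of (F.onHor J)) c.lamι (c.lam J) (.nul M), c.IsChi J χ ∧
    χ = L.hcomp (L.hcomp c.isoι.hom (L.whisker (F.onCell χ') ε) rfl) (c.iso J).hom rfl

end YonedaChoice

end AugVDCFunctor

universe u v w x u' v' w' x'

/-! The equivalence comes from one commutative square of maps between sets of cells. Fix `J : A' ⇸
B`, `h`, `k` and a path `P`, and start from the cells `P ⇒ J` with boundary `h`, `k`. On one side,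
transpose and compose with the cartesian cell `J^♭ ⇒ P_A`. On the other, compose with `χ^{J♯}`,
apply `ε ∘ F-`, correct the vertical boundary by `σ` and `τ_J`, and compose horizontally on the left
with the nullary cartesian cell on `ι(id, Fh)`. Both routes end in the nullary cells `ι(id, Fh) ⌢ FP
⇒ P_A`, and they agree by the equations defining `χ^J` and `χ^{J♯}`. Apart from transposition and
composition with `χ^{J♯}`, every map involved is bijective: by cartesianness, by local universality
of `ε`, by invertibility of `σ` and `τ_J`, and because density of `y_A` makes the cell on `ι(id,
Fh)` left Kan. So transposition is bijective exactly when composition with `χ^{J♯}` is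
(`transpose_bijective_iff`); ranging over `h`, `k`, `P`, this compares condition (c) with
cartesianness of `χ^{J♯}`.

The other ingredient is that `χ^J` and `χ^{J♯}` are always left Kan. The cartesian cells on `ι` and
on `J^♭` are left Kan by density, so `χ^J` is left Kan by cancellation along the right composite
(`IsLeftKan.of_hcomp`), and `ε ∘ F-` reflects left Kan cells (`IsLocallyUniversal.isLeftKan`). For
the unit `I` of `A'`, whose invertibility `F` preserves, this forces `ι^λ ≅ (I^♭)^λ`; hence `ι^λ` is
isomorphic to a small morphism and `y_{A'}` exists.

Once the cells `χ^{J♯}` are cartesian, density of `y_{A'}` follows because every `l : B ⟶ P_{A'}` is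
isomorphic to some `H^{λ'}`, so that cartesian cells with target `l` can be compared with `χ^{H♯}`.
Full faithfulness is read off from `χ^{I♯}`. For the companion of `y_{A'}`, its cartesian cell and
`χ♯` are both left Kan, so its `λ'` is isomorphic to `id`; applying `ε ∘ F-` identifies the morphism
that classifies its adjunct with `ε`. -/

namespace AugVDC

open AugVirt

/-! ### Associativity, interchange and cartesian cells -/

section Calculus

variable {K : AugVDC.{u, v, w, x}}

/-- All boundary equations are free parameters, so that cells with only propositionally equal
boundaries can be compared without transport. The same device is used throughout. -/
theorem comp_comp {A B C D E F X Y : K.Obj} {P : HPath K.Hor A B} {f : A ⟶ C} {g : B ⟶ D}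
    {Q : HPath K.Hor C D} {h : C ⟶ E} {k : D ⟶ F} {T : HTarget K.Hor E F} {R : HPath K.Hor E F}
    {p : E ⟶ X} {q : F ⟶ Y} {T' : HTarget K.Hor X Y} (s : CellSeq K.toGraph P f g Q)
    (ψ : K.Cell Q h k T) (hR : R = T.toPath) (χ : K.Cell R p q T')
    {f' : A ⟶ E} {g' : B ⟶ F} {p' : C ⟶ X} {q' : D ⟶ Y} {f'' : A ⟶ X} {g'' : B ⟶ Y}
    (hf : f ≫ h = f') (hg : g ≫ k = g') (hf' : f' ≫ p = f'') (hg' : g' ≫ q = g'')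
    (hp : h ≫ p = p') (hq : k ≫ q = q') (hp' : f ≫ p' = f'') (hq' : g ≫ q' = g'') :
    K.comp (.single (K.comp s ψ hf hg) hR) χ hf' hg' =
      K.comp s (K.comp (.single ψ hR) χ hp hq) hp' hq' := by
  subst hf hg hp hq hp' hq'
  exact K.assoc (.single s ψ hR) χ

theorem comp_comp₂ {A B C A₁ B₁ C₁ A₂ B₂ C₂ X Y : K.Obj}
    {P₁ : HPath K.Hor A B} {P₂ : HPath K.Hor B C} {P : HPath K.Hor A C}
    {Q₁ : HPath K.Hor A₁ B₁} {Q₂ : HPath K.Hor B₁ C₁} {Q : HPath K.Hor A₁ C₁}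
    {T₁ : HTarget K.Hor A₂ B₂} {T₂ : HTarget K.Hor B₂ C₂}
    {R₂ : HPath K.Hor B₂ C₂} {R : HPath K.Hor A₂ C₂}
    {f₁ : A ⟶ A₁} {m₁ : B ⟶ B₁} {g₁ : C ⟶ C₁} {f₂ : A₁ ⟶ A₂} {m₂ : B₁ ⟶ B₂} {g₂ : C₁ ⟶ C₂}
    {p : A₂ ⟶ X} {q : C₂ ⟶ Y} {T : HTarget K.Hor X Y}
    (s : CellSeq K.toGraph P₁ f₁ m₁ Q₁) (t : CellSeq K.toGraph P₂ m₁ g₁ Q₂)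
    (φ : K.Cell Q₁ f₂ m₂ T₁) (ψ : K.Cell Q₂ m₂ g₂ T₂) (χ : K.Cell R p q T)
    (hP : P = P₁.comp P₂) (hQ : Q = Q₁.comp Q₂) (hR₂ : R₂ = T₂.toPath)
    (hR : R = T₁.toPath.comp R₂)
    {f' : A ⟶ A₂} {m' : B ⟶ B₂} {g' : C ⟶ C₂} {p' : A₁ ⟶ X} {q' : C₁ ⟶ Y}
    {f'' : A ⟶ X} {g'' : C ⟶ Y}
    (hf : f₁ ≫ f₂ = f') (hm : m₁ ≫ m₂ = m') (hg : g₁ ≫ g₂ = g') (hf' : f' ≫ p = f'')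
    (hg' : g' ≫ q = g'') (hp : f₂ ≫ p = p') (hq : g₂ ≫ q = q') (hp' : f₁ ≫ p' = f'')
    (hq' : g₁ ≫ q' = g'') :
    K.comp (.cons (K.comp s φ hf hm) (.single (K.comp t ψ hm hg) hR₂) hP hR) χ hf' hg' =
      K.comp (s.append t hP hQ) (K.comp (.cons φ (.single ψ hR₂) hQ hR) χ hp hq) hp' hq' := by
  subst hf hm hg hp hq hp' hq'
  exact K.assoc (.cons s φ (.single t ψ hR₂) hP hQ hR) χ

/-- Composition distributes over horizontal composition. -/
theorem comp_hcomp {A B C A₁ B₁ C₁ M : K.Obj}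
    {P₁ : HPath K.Hor A B} {P₂ : HPath K.Hor B C} {P : HPath K.Hor A C}
    {Q₁ : HPath K.Hor A₁ B₁} {Q₂ : HPath K.Hor B₁ C₁} {Q : HPath K.Hor A₁ C₁}
    {f₁ : A ⟶ A₁} {m₁ : B ⟶ B₁} {g₁ : C ⟶ C₁} {f₂ : A₁ ⟶ M} {m₂ : B₁ ⟶ M} {g₂ : C₁ ⟶ M}
    (s : CellSeq K.toGraph P₁ f₁ m₁ Q₁) (t : CellSeq K.toGraph P₂ m₁ g₁ Q₂)
    (φ : K.Cell Q₁ f₂ m₂ (.nul M)) (ψ : K.Cell Q₂ m₂ g₂ (.nul M))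
    (hP : P = P₁.comp P₂) (hQ : Q = Q₁.comp Q₂)
    {f' : A ⟶ M} {m' : B ⟶ M} {g' : C ⟶ M}
    (hf : f₁ ≫ f₂ = f') (hm : m₁ ≫ m₂ = m') (hg : g₁ ≫ g₂ = g') :
    K.comp (s.append t hP hQ) (K.hcomp φ ψ hQ) hf hg =
      K.hcomp (K.comp s φ hf hm) (K.comp t ψ hm hg) hP :=
  (K.comp_comp₂ s t φ ψ (K.idV (𝟙 M)) hP hQ rfl rfl hf hm hg (Category.comp_id _)
    (Category.comp_id _) (Category.comp_id _) (Category.comp_id _) hf hg).symm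

/-- The vertical cell `σ` has empty horizontal source, so no part of `s` lies above it. Inserting
`id_f` in front of `s`, which does not change the composite, supplies the missing cell. -/
theorem comp_vert_hcomp {A B C D M : K.Obj} {P : HPath K.Hor A B} {Q : HPath K.Hor C D}
    {f : A ⟶ C} {g : B ⟶ D} {a b : C ⟶ M} {c : D ⟶ M} (s : CellSeq K.toGraph P f g Q)
    (σ : K.Cell (.nil C) a b (.nul M)) (ψ : K.Cell Q b c (.nul M))
    {a' b' : A ⟶ M} {c' : B ⟶ M} (ha : f ≫ a = a') (hb : f ≫ b = b') (hc : g ≫ c = c') :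
    K.comp s (K.hcomp σ ψ rfl) ha hc =
      K.hcomp (K.comp (.single (K.idV f) rfl) σ ha hb) (K.comp s ψ hb hc) rfl :=
  (K.insert_left' s (K.hcomp σ ψ rfl) ha hc).symm.trans
    (K.comp_hcomp (.single (K.idV f) rfl) s σ ψ rfl rfl ha hb hc)

theorem comp_hcomp_vert {A B C D M : K.Obj} {P : HPath K.Hor A B} {Q : HPath K.Hor C D}
    {f : A ⟶ C} {g : B ⟶ D} {a : C ⟶ M} {b c : D ⟶ M} (s : CellSeq K.toGraph P f g Q)
    (ψ : K.Cell Q a b (.nul M)) (τ : K.Cell (.nil D) b c (.nul M))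
    {a' : A ⟶ M} {b' c' : B ⟶ M} (ha : f ≫ a = a') (hb : g ≫ b = b') (hc : g ≫ c = c') :
    K.comp s (K.hcomp ψ τ (HPath.comp_nil Q).symm) ha hc =
      K.hcomp (K.comp s ψ ha hb) (K.comp (.single (K.idV g) rfl) τ hb hc)
        (HPath.comp_nil P).symm :=
  (K.insert_right' s (K.hcomp ψ τ _) ha hc).symm.trans
    (K.comp_hcomp s (.single (K.idV g) rfl) ψ τ _ _ ha hb hc)

theorem comp_id' {A B C D : K.Obj} {P : HPath K.Hor A B} {f : A ⟶ C} {g : B ⟶ D}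
    {T : HTarget K.Hor C D} (φ : K.Cell P f g T) (hf : 𝟙 A ≫ f = f) (hg : 𝟙 B ≫ g = g) :
    K.comp (K.idSeq P) φ hf hg = φ :=
  K.comp_id φ

/-- The identity cell of a horizontal target. -/
def idT (K : AugVDC.{u, v, w, x}) :
    ∀ {A B : K.Obj} (S : HTarget K.Hor A B), K.Cell S.toPath (𝟙 A) (𝟙 B) S
  | _, _, .nul A => K.idV (𝟙 A)
  | _, _, .un J => K.idH J rfl rfl

theorem comp_idT {A B C D : K.Obj} {P : HPath K.Hor A B} {f : A ⟶ C} {g : B ⟶ D}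
    {T : HTarget K.Hor C D} (φ : K.Cell P f g T) (hf : f ≫ 𝟙 C = f) (hg : g ≫ 𝟙 D = g) :
    K.comp (.single φ rfl) (K.idT T) hf hg = φ := by
  cases T
  · exact K.idV_comp φ
  · exact K.idH_comp φ

theorem idH_isCartesian {A B : K.Obj} (J : K.Hor A B) :
    K.IsCartesian (S := .un J) (K.idH J rfl rfl) := by
  intro X Y P h k χ
  -- The boundary `h ≫ 𝟙 A` is generalised to a variable so that it can be replaced by `h`.
  have key : ∀ {h' : X ⟶ A} {k' : Y ⟶ B} (hh : h ≫ 𝟙 A = h') (hk : k ≫ 𝟙 B = k')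
      (χ : K.Cell P h' k' (.un J)),
      ∃! φ : K.Cell P h k (.un J), K.comp (.single φ rfl) (K.idH J rfl rfl) hh hk = χ := by
    intro h' k' hh hk χ
    obtain rfl : h = h' := by simpa using hh
    obtain rfl : k = k' := by simpa using hk
    exact ⟨χ, K.idH_comp χ, fun φ hφ => (K.idH_comp φ).symm.trans hφ⟩
  exact key rfl rfl χ

theorem IsCartesian.existsUnique {A B C D : K.Obj} {S : HTarget K.Hor A B}
    {f : A ⟶ C} {g : B ⟶ D} {T : HTarget K.Hor C D} {ψ : K.Cell S.toPath f g T}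
    (hψ : K.IsCartesian ψ) {X Y : K.Obj} {P : HPath K.Hor X Y} {h : X ⟶ A} {k : Y ⟶ B}
    {h' : X ⟶ C} {k' : Y ⟶ D} (hh : h ≫ f = h') (hk : k ≫ g = k') (χ : K.Cell P h' k' T) :
    ∃! φ : K.Cell P h k S, K.comp (.single φ rfl) ψ hh hk = χ := by
  subst hh hk
  exact hψ P h k χ

/-- Unique factorisation is recast as bijectivity, as for left Kan and cocartesian cells below:
later arguments paste such maps and cancel bijections. -/
theorem isCartesian_of_bijective {A B C D : K.Obj} {S : HTarget K.Hor A B}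
    {f : A ⟶ C} {g : B ⟶ D} {T : HTarget K.Hor C D} {ψ : K.Cell S.toPath f g T}
    (hψ : ∀ {X Y : K.Obj} (P : HPath K.Hor X Y) (h : X ⟶ A) (k : Y ⟶ B),
      Function.Bijective fun φ : K.Cell P h k S => K.comp (.single φ rfl) ψ rfl rfl) :
    K.IsCartesian ψ :=
  fun P h k => (Function.bijective_iff_existsUnique _).1 (hψ P h k)

theorem IsCartesian.bijective {A B C D : K.Obj} {S : HTarget K.Hor A B}
    {f : A ⟶ C} {g : B ⟶ D} {T : HTarget K.Hor C D} {ψ : K.Cell S.toPath f g T}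
    (hψ : K.IsCartesian ψ) {X Y : K.Obj} (P : HPath K.Hor X Y) (h : X ⟶ A) (k : Y ⟶ B)
    {h' : X ⟶ C} {k' : Y ⟶ D} (hh : h ≫ f = h') (hk : k ≫ g = k') :
    Function.Bijective fun φ : K.Cell P h k S => K.comp (.single φ rfl) ψ hh hk :=
  (Function.bijective_iff_existsUnique _).2 fun χ => hψ.existsUnique hh hk χ

/-- Cartesian cells compose. -/
theorem IsCartesian.comp {A B A₁ B₁ A₂ B₂ : K.Obj} {S : HTarget K.Hor A B}
    {T : HTarget K.Hor A₁ B₁} {U : HTarget K.Hor A₂ B₂} {f : A ⟶ A₁} {g : B ⟶ B₁}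
    {h : A₁ ⟶ A₂} {k : B₁ ⟶ B₂} {φ : K.Cell S.toPath f g T} {ψ : K.Cell T.toPath h k U}
    (hφ : K.IsCartesian φ) (hψ : K.IsCartesian ψ) {f' : A ⟶ A₂} {g' : B ⟶ B₂}
    (hf : f ≫ h = f') (hg : g ≫ k = g') :
    K.IsCartesian (K.comp (.single φ rfl) ψ hf hg) := by
  refine isCartesian_of_bijective fun P p q => ?_
  have h1 := (hψ.bijective P (p ≫ f) (q ≫ g) (h' := p ≫ f') (k' := q ≫ g')
    (by simp [← hf]) (by simp [← hg])).comp (hφ.bijective P p q rfl rfl)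
  refine (congrArg Function.Bijective ?_).mp h1
  funext χ
  exact K.comp_comp _ _ _ _ _ _ _ _ _ _ _ _

/-- Invertible cells, with identities as vertical boundary, are cartesian. -/
theorem isCartesian_of_inverse {A B : K.Obj} {S T : HTarget K.Hor A B}
    (α : K.Cell S.toPath (𝟙 A) (𝟙 B) T) (β : K.Cell T.toPath (𝟙 A) (𝟙 B) S)
    (hαβ : K.comp (.single α rfl) β (Category.comp_id _) (Category.comp_id _) = K.idT S)
    (hβα : K.comp (.single β rfl) α (Category.comp_id _) (Category.comp_id _) = K.idT T) :
    K.IsCartesian α := by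
  intro X Y P h k χ
  have key : ∀ {h' : X ⟶ A} {k' : Y ⟶ B} (hh : h ≫ 𝟙 A = h') (hk : k ≫ 𝟙 B = k')
      (χ : K.Cell P h' k' T),
      ∃! φ : K.Cell P h k S, K.comp (.single φ rfl) α hh hk = χ := by
    intro h' k' hh hk χ
    obtain rfl : h = h' := by simpa using hh
    obtain rfl : k = k' := by simpa using hk
    refine ⟨K.comp (.single χ rfl) β hh hk, ?_, ?_⟩
    · refine (K.comp_comp _ _ _ _ _ _ _ _ (Category.comp_id _) (Category.comp_id _) hh hk).trans ?_
      rw [hβα, comp_idT]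
    · rintro φ rfl
      refine Eq.symm ((K.comp_comp _ _ _ _ _ _ _ _ (Category.comp_id _) (Category.comp_id _)
        hh hk).trans ?_)
      rw [hαβ, comp_idT]
  exact key rfl rfl χ

end Calculus

/-! ### Vertical isomorphisms -/

section Kan

variable {K : AugVDC.{u, v, w, x}}

theorem hcomp_congr {A B C M : K.Obj} {P₁ : HPath K.Hor A B} {P₂ : HPath K.Hor B C}
    {P : HPath K.Hor A C} {f : A ⟶ M} {g : B ⟶ M} {h : C ⟶ M}
    {φ φ' : K.Cell P₁ f g (.nul M)} {ψ ψ' : K.Cell P₂ g h (.nul M)} {hP : P = P₁.comp P₂}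
    (hφ : φ = φ') (hψ : ψ = ψ') : K.hcomp φ ψ hP = K.hcomp φ' ψ' hP := by
  rw [hφ, hψ]

theorem comp_congr {A B C D E F : K.Obj} {P : HPath K.Hor A B} {Q : HPath K.Hor C D} {f : A ⟶ C}
    {g : B ⟶ D} {h : C ⟶ E} {k : D ⟶ F} {T : HTarget K.Hor E F} {f' : A ⟶ E} {g' : B ⟶ F}
    {s : CellSeq K.toGraph P f g Q} {ψ ψ' : K.Cell Q h k T} {hf : f ≫ h = f'} {hg : g ≫ k = g'}
    (hψ : ψ = ψ') : K.comp s ψ hf hg = K.comp s ψ' hf hg := by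
  rw [hψ]

theorem comp_single_congr {A B C D E F : K.Obj} {P : HPath K.Hor A B} {Q : HPath K.Hor C D}
    {f : A ⟶ C} {g : B ⟶ D} {h : C ⟶ E} {k : D ⟶ F} {S : HTarget K.Hor C D}
    {T : HTarget K.Hor E F} {f' : A ⟶ E} {g' : B ⟶ F} {φ φ' : K.Cell P f g S}
    {hQ : Q = S.toPath} {ψ : K.Cell Q h k T} {hf : f ≫ h = f'} {hg : g ≫ k = g'}
    (hφ : φ = φ') : K.comp (.single φ hQ) ψ hf hg = K.comp (.single φ' hQ) ψ hf hg := by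
  rw [hφ]

namespace VertIso

variable {A M : K.Obj} {f g h : A ⟶ M}

/-- The inverse of a vertical isomorphism. -/
def symm (θ : K.VertIso f g) : K.VertIso g f := ⟨θ.inv, θ.hom, θ.inv_hom, θ.hom_inv⟩

theorem hcomp_left_bijective (θ : K.VertIso f g) {B : K.Obj} (P : HPath K.Hor A B) (k : B ⟶ M) :
    Function.Bijective fun ψ : K.Cell P g k (.nul M) => K.hcomp θ.hom ψ (P := P) rfl := by
  refine Function.bijective_iff_has_inverse.2 ⟨fun ψ => K.hcomp θ.inv ψ rfl, fun ψ => ?_,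
    fun ψ => ?_⟩
  · refine (K.hcomp_assoc θ.inv θ.hom ψ rfl rfl rfl rfl).symm.trans ?_
    exact (hcomp_congr θ.inv_hom rfl).trans (K.idV_hcomp ψ)
  · refine (K.hcomp_assoc θ.hom θ.inv ψ rfl rfl rfl rfl).symm.trans ?_
    exact (hcomp_congr θ.hom_inv rfl).trans (K.idV_hcomp ψ)

theorem hcomp_right_bijective (θ : K.VertIso f g) {B : K.Obj} (P : HPath K.Hor B A) (k : B ⟶ M) :
    Function.Bijective fun ψ : K.Cell P k f (.nul M) =>
      K.hcomp ψ θ.hom (HPath.comp_nil P).symm := by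
  refine Function.bijective_iff_has_inverse.2
    ⟨fun ψ => K.hcomp ψ θ.inv (HPath.comp_nil P).symm, fun ψ => ?_, fun ψ => ?_⟩
  · refine (K.hcomp_assoc ψ θ.hom θ.inv _ rfl _ (HPath.comp_nil P).symm).trans ?_
    exact (hcomp_congr rfl θ.hom_inv).trans (K.hcomp_idV ψ)
  · refine (K.hcomp_assoc ψ θ.inv θ.hom _ rfl _ (HPath.comp_nil P).symm).trans ?_
    exact (hcomp_congr rfl θ.inv_hom).trans (K.hcomp_idV ψ)

/-- The composite of vertical isomorphisms. -/
def trans (θ : K.VertIso f g) (ζ : K.VertIso g h) : K.VertIso f h where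
  hom := K.hcomp θ.hom ζ.hom rfl
  inv := K.hcomp ζ.inv θ.inv rfl
  hom_inv := by
    refine (K.hcomp_assoc _ _ _ rfl rfl rfl rfl).trans ?_
    exact (hcomp_congr rfl (((K.hcomp_assoc ζ.hom ζ.inv θ.inv rfl rfl rfl rfl).symm.trans
      (hcomp_congr ζ.hom_inv rfl)).trans (K.idV_hcomp θ.inv))).trans θ.hom_inv
  inv_hom := by
    refine (K.hcomp_assoc _ _ _ rfl rfl rfl rfl).trans ?_
    exact (hcomp_congr rfl (((K.hcomp_assoc θ.inv θ.hom ζ.hom rfl rfl rfl rfl).symm.trans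
      (hcomp_congr θ.inv_hom rfl)).trans (K.idV_hcomp ζ.hom))).trans ζ.inv_hom

/-- Precomposition of a vertical isomorphism with a vertical morphism. -/
def precomp (θ : K.VertIso f g) {B : K.Obj} (p : B ⟶ A) {f' g' : B ⟶ M} (hf : p ≫ f = f')
    (hg : p ≫ g = g') : K.VertIso f' g' where
  hom := K.comp (.single (K.idV p) rfl) θ.hom hf hg
  inv := K.comp (.single (K.idV p) rfl) θ.inv hg hf
  hom_inv := by
    refine (K.comp_vert_hcomp (.single (K.idV p) rfl) θ.hom θ.inv hf hg hf).symm.trans ?_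
    exact (comp_congr θ.hom_inv).trans (K.idV_comp_idV' hf)
  inv_hom := by
    refine (K.comp_vert_hcomp (.single (K.idV p) rfl) θ.inv θ.hom hg hf hg).symm.trans ?_
    exact (comp_congr θ.inv_hom).trans (K.idV_comp_idV' hg)

end VertIso

/-- Factoring through the new cell amounts to factoring through `ψ` and then composing with `θ`
precomposed by `k`, which is again invertible. -/
theorem IsCartesian.hcomp_vertIso {A B M : K.Obj} {S : HTarget K.Hor A B} {f : A ⟶ M}
    {g g' : B ⟶ M} {ψ : K.Cell S.toPath f g (.nul M)} (hψ : K.IsCartesian ψ)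
    (θ : K.VertIso g g') :
    K.IsCartesian (S := S) (K.hcomp ψ θ.hom (HPath.comp_nil _).symm) := by
  refine isCartesian_of_bijective fun P h k => ?_
  refine (congrArg Function.Bijective ?_).mp
    (((θ.precomp k rfl rfl).hcomp_right_bijective P (h ≫ f)).comp (hψ.bijective P h k rfl rfl))
  funext φ
  exact (K.comp_hcomp_vert (.single φ rfl) ψ θ.hom rfl rfl rfl).symm

/-! ### Left Kan cells and their uniqueness -/

theorem IsLeftKan.existsUnique {A B M : K.Obj} {P : HPath K.Hor A B} {d : A ⟶ M} {l : B ⟶ M}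
    {η : K.Cell P d l (.nul M)} (hη : K.IsLeftKan η) {C : K.Obj} {H : HPath K.Hor B C}
    {R : HPath K.Hor A C} (hR : R = P.comp H) {k : C ⟶ M} (φ : K.Cell R d k (.nul M)) :
    ∃! φ' : K.Cell H l k (.nul M), K.hcomp η φ' hR = φ := by
  subst hR
  exact hη H k φ

theorem IsLeftKan.bijective {A B M : K.Obj} {P : HPath K.Hor A B} {d : A ⟶ M} {l : B ⟶ M}
    {η : K.Cell P d l (.nul M)} (hη : K.IsLeftKan η) {C : K.Obj} {H : HPath K.Hor B C}
    {R : HPath K.Hor A C} (hR : R = P.comp H) (k : C ⟶ M) :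
    Function.Bijective fun φ' : K.Cell H l k (.nul M) => K.hcomp η φ' hR :=
  (Function.bijective_iff_existsUnique _).2 fun φ => hη.existsUnique hR φ

theorem isLeftKan_of_bijective {A B M : K.Obj} {P : HPath K.Hor A B} {d : A ⟶ M} {l : B ⟶ M}
    {η : K.Cell P d l (.nul M)}
    (hη : ∀ {C : K.Obj} (H : HPath K.Hor B C) (k : C ⟶ M),
      Function.Bijective fun φ' : K.Cell H l k (.nul M) => K.hcomp η φ' rfl) :
    K.IsLeftKan η :=
  fun H k => (Function.bijective_iff_existsUnique _).1 (hη H k)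

theorem IsLeftKan.hcomp_vertIso {A B M : K.Obj} {P : HPath K.Hor A B} {d : A ⟶ M} {l l' : B ⟶ M}
    {η : K.Cell P d l (.nul M)} (hη : K.IsLeftKan η) (θ : K.VertIso l l') :
    K.IsLeftKan (K.hcomp η θ.hom (HPath.comp_nil P).symm) := by
  refine isLeftKan_of_bijective fun H k => ?_
  refine (congrArg Function.Bijective ?_).mp
    ((hη.bijective rfl k).comp (θ.hcomp_left_bijective H k))
  funext φ
  exact (K.hcomp_assoc η θ.hom φ (HPath.comp_nil P).symm rfl rfl rfl).symm

theorem IsLeftKan.of_hcomp_vertIso {A B M : K.Obj} {P : HPath K.Hor A B} {d : A ⟶ M}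
    {l l' : B ⟶ M} {η : K.Cell P d l (.nul M)} (θ : K.VertIso l l')
    (hη : K.IsLeftKan (K.hcomp η θ.hom (HPath.comp_nil P).symm)) : K.IsLeftKan η := by
  refine isLeftKan_of_bijective fun H k => ?_
  refine (Function.Bijective.of_comp_iff _ (θ.hcomp_left_bijective H k)).1 ?_
  refine (congrArg Function.Bijective ?_).mp (hη.bijective rfl k)
  funext φ
  exact K.hcomp_assoc η θ.hom φ (HPath.comp_nil P).symm rfl rfl rfl

/-- A cartesian cell is left Kan if it has the same vertical boundary as some cartesian left Kan
cell, and its horizontal source is that of some left Kan cell. -/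
theorem IsLeftKan.of_isCartesian {A B M : K.Obj} {J H : K.Hor A B} {y : A ⟶ M} {l l' : B ⟶ M}
    {η : K.Cell (.of J) y l (.nul M)} (hη : K.IsCartesian (S := .un J) η)
    {ζ : K.Cell (.of H) y l (.nul M)} (hζ : K.IsCartesian (S := .un H) ζ)
    (hζ' : K.IsLeftKan ζ) {χ : K.Cell (.of J) y l' (.nul M)} (hχ : K.IsLeftKan χ) :
    K.IsLeftKan η := by
  have hy := Category.id_comp y
  have hl := Category.id_comp l
  have hl' := Category.id_comp l'
  -- Two cartesian cells with the same boundary have isomorphic sources: `ζ ∘ α = η` and `η ∘ β =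
  -- ζ`.
  obtain ⟨α, hα, -⟩ := hζ.existsUnique hy hl η
  obtain ⟨β, hβ, -⟩ := hη.existsUnique hy hl ζ
  have hαβ : K.comp (.single α rfl) β (Category.comp_id _) (Category.comp_id _) =
      K.idH J rfl rfl := by
    refine (hη.bijective _ (𝟙 A) (𝟙 B) hy hl).1 ?_
    refine (K.comp_comp (.single α rfl) β rfl η _ _ hy hl hy hl hy hl).trans ?_
    exact ((comp_congr hβ).trans hα).trans (K.comp_id η).symm
  -- Here `χ ⊙ a = η` and `ζ ⊙ b = χ ∘ β`. Once `a` and `b` are seen to be inverse, `η` is a left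
  -- Kan cell followed by a vertical isomorphism. Up to there only empty extension paths occur, so
  -- `α` and `β` need not be extended by paths of identities.
  obtain ⟨a, ha, -⟩ := hχ.existsUnique (H := .nil B) rfl η
  obtain ⟨b, hb, -⟩ := hζ'.existsUnique (H := .nil B) rfl (K.comp (.single β rfl) χ hy hl')
  have hab : K.hcomp a b rfl = K.idV l' := by
    refine (hχ.bijective (H := .nil B) rfl l').1 ?_
    refine (K.hcomp_assoc χ a b rfl rfl rfl rfl).symm.trans ((hcomp_congr ha rfl).trans ?_)
    refine ((hcomp_congr hα (K.comp_id b)).symm.trans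
      (K.comp_hcomp_vert (.single α rfl) ζ b hy hl hl').symm).trans ?_
    refine (comp_congr hb).trans ?_
    refine (K.comp_comp (.single α rfl) β rfl χ (Category.comp_id _) (Category.comp_id _)
      hy hl' hy hl' hy hl').symm.trans ?_
    exact ((comp_single_congr hαβ).trans (K.comp_id χ)).trans (K.hcomp_idV χ).symm
  have hba : K.hcomp b a rfl = K.idV l := by
    refine (hζ'.bijective (H := .nil B) rfl l).1 ?_
    refine (K.hcomp_assoc ζ b a rfl rfl rfl rfl).symm.trans ((hcomp_congr hb rfl).trans ?_)
    refine ((hcomp_congr rfl (K.comp_id a)).symm.trans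
      (K.comp_hcomp_vert (.single β rfl) χ a hy hl' hl).symm).trans ?_
    exact ((comp_congr ha).trans hβ).trans (K.hcomp_idV ζ).symm
  rw [← ha]
  intro C H k
  exact hχ.hcomp_vertIso ⟨a, b, hab, hba⟩ H k

/-- Left Kan extensions are unique up to vertical isomorphism. -/
theorem IsLeftKan.exists_vertIso {A B M : K.Obj} {P : HPath K.Hor A B} {d : A ⟶ M}
    {l l' : B ⟶ M} {η : K.Cell P d l (.nul M)} {η' : K.Cell P d l' (.nul M)}
    (hη : K.IsLeftKan η) (hη' : K.IsLeftKan η') :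
    ∃ θ : K.VertIso l l', K.hcomp η θ.hom (HPath.comp_nil P).symm = η' := by
  have hP := (HPath.comp_nil P).symm
  obtain ⟨a, ha, -⟩ := hη.existsUnique hP η'
  obtain ⟨b, hb, -⟩ := hη'.existsUnique hP η
  refine ⟨⟨a, b, (hη.bijective hP l).1 ?_, (hη'.bijective hP l').1 ?_⟩, ha⟩
  · refine (K.hcomp_assoc η a b hP rfl hP hP).symm.trans ?_
    rw [ha, hb]
    exact (K.hcomp_idV η).symm
  · refine (K.hcomp_assoc η' b a hP rfl hP hP).symm.trans ?_
    rw [hb, ha]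
    exact (K.hcomp_idV η').symm

/-! ### Right cocartesian cells, the pasting law and horizontal units -/

theorem IsWeaklyNullaryCocartesian.bijective {A B C D : K.Obj} {P : HPath K.Hor A B} {f : A ⟶ C}
    {g : B ⟶ D} {Q : HPath K.Hor C D} {s : CellSeq K.toGraph P f g Q}
    (hs : K.IsWeaklyNullaryCocartesian s) {E : K.Obj} {h : C ⟶ E} {k : D ⟶ E} {f' : A ⟶ E}
    {g' : B ⟶ E} (hf : f ≫ h = f') (hg : g ≫ k = g') :
    Function.Bijective fun χ : K.Cell Q h k (.nul E) => K.comp s χ hf hg := by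
  subst hf hg
  exact (Function.bijective_iff_existsUnique _).2 (hs h k)

theorem IsWeaklyUnaryCocartesian.bijective {A B C D : K.Obj} {P : HPath K.Hor A B} {f : A ⟶ C}
    {g : B ⟶ D} {Q : HPath K.Hor C D} {s : CellSeq K.toGraph P f g Q}
    (hs : K.IsWeaklyUnaryCocartesian s) {E F : K.Obj} {h : C ⟶ E} {k : D ⟶ F} {J : K.Hor E F}
    {f' : A ⟶ E} {g' : B ⟶ F} (hf : f ≫ h = f') (hg : g ≫ k = g') :
    Function.Bijective fun χ : K.Cell Q h k (.un J) => K.comp s χ hf hg := by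
  subst hf hg
  exact (Function.bijective_iff_existsUnique _).2 (hs h k J)

/-- The definition extends by a cartesian cell defining `K₁(g, id)`. Here `g` is an identity, so
`id_{K₁}` is such a cell, and the extension becomes a path of identities, as left Kan cells require.
-/
theorem IsRightNullaryCocartesian.bijective {A X B : K.Obj} {H₁ : K.Hor A X} {H₂ : K.Hor X B}
    {J : K.Hor A B}
    {φ : K.Cell ((HPath.of H₁).comp (.of H₂)) (𝟙 A) (𝟙 B) (.un J)}
    (hφ : K.IsRightNullaryCocartesian (.single φ rfl)) {C E : K.Obj} (H : HPath K.Hor B C)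
    (h : A ⟶ E) (k : C ⟶ E) :
    Function.Bijective fun χ : K.Cell ((HPath.of J).comp H) h k (.nul E) =>
      K.comp (.cons φ (K.idSeq H) (P := (HPath.of H₁).comp ((HPath.of H₂).comp H)) rfl rfl) χ
        (Category.id_comp h) (Category.id_comp k) := by
  cases H with
  | nil =>
    refine (congrArg Function.Bijective ?_).mp
      (IsWeaklyNullaryCocartesian.bijective hφ.1 (Category.id_comp h) (Category.id_comp k))
    funext χ
    exact (K.insert_right' (.single φ rfl) χ (Category.id_comp h) (Category.id_comp k)).symm
  | cons K₁ R =>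
    have h1 := IsWeaklyNullaryCocartesian.bijective
      (hφ.2 K₁ R K₁ ⟨K.idH K₁ rfl rfl, idH_isCartesian K₁⟩) (Category.id_comp h) (Category.id_comp k)
    cases R with
    | cons J' R => exact h1
    -- The identity path of the empty tail contributes an extra vertical identity, which is neutral.
    | nil =>
      refine (congrArg Function.Bijective ?_).mp h1
      funext χ
      exact K.insert_right' (.cons φ (.single (K.idH K₁ rfl rfl) rfl) rfl rfl) χ
        (Category.id_comp h) (Category.id_comp k)

/-- The pasting law for left Kan extensions along right composites. -/
theorem IsLeftKan.of_hcomp {A X B M : K.Obj} {H₁ : K.Hor A X} {H₂ : K.Hor X B}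
    {J : K.Hor A B} {φ : K.Cell ((HPath.of H₁).comp (.of H₂)) (𝟙 A) (𝟙 B) (.un J)}
    (hφ : K.IsRightNullaryCocartesian (.single φ rfl)) {d : A ⟶ M} {l : X ⟶ M} {l' : B ⟶ M}
    {η : K.Cell (.of H₁) d l (.nul M)} (hη : K.IsLeftKan η)
    {η' : K.Cell (.of J) d l' (.nul M)} (hη' : K.IsLeftKan η')
    {χ : K.Cell (.of H₂) l l' (.nul M)}
    (hχ : K.comp (.single φ rfl) η' (Category.id_comp d) (Category.id_comp l') =
      K.hcomp η χ rfl) : K.IsLeftKan χ := by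
  refine isLeftKan_of_bijective fun H k => ?_
  -- The identity `η ⊙ (χ ⊙ ψ) = (η' ⊙ ψ) ∘ (φ, id_H)` expresses `χ ⊙ -` followed by a bijection as
  -- a composite of two bijections.
  refine (Function.Bijective.of_comp_iff' (hη.bijective rfl k) _).1 ?_
  refine (congrArg Function.Bijective ?_).mp
    ((hφ.bijective H d k).comp (hη'.bijective rfl k))
  funext ψ
  refine (K.comp_hcomp (.single φ rfl) (K.idSeq H) η' ψ rfl rfl (Category.id_comp d)
    (Category.id_comp l') (Category.id_comp k)).trans ?_
  rw [hχ, comp_id']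
  exact K.hcomp_assoc η χ ψ rfl rfl rfl rfl

/-- Every unital object admits a horizontal unit. -/
theorem IsUnital.exists_unit {A : K.Obj} (hA : K.IsUnital A) :
    ∃ (I : K.Hor A A) (ε : K.Cell (.of I) (𝟙 A) (𝟙 A) (.nul A))
      (κ : K.Cell (.nil A) (𝟙 A) (𝟙 A) (.un I)),
      K.comp (.single κ rfl) ε (Category.comp_id _) (Category.comp_id _) = K.idV (𝟙 A) ∧
      K.comp (.single ε rfl) κ (Category.comp_id _) (Category.comp_id _) = K.idH I rfl rfl := by
  obtain ⟨I, ⟨⟨ε, hε⟩⟩⟩ := hA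
  obtain ⟨κ, hκ, -⟩ := hε.existsUnique (Category.comp_id _) (Category.comp_id _) (K.idV (𝟙 A))
  refine ⟨I, ε, κ, hκ, (hε.bijective _ (𝟙 A) (𝟙 A) (Category.comp_id _)
    (Category.comp_id _)).1 ?_⟩
  refine (K.comp_comp _ _ _ _ _ _ _ _ (Category.comp_id _) (Category.comp_id _)
    (Category.comp_id _) (Category.comp_id _)).trans ?_
  refine (comp_congr hκ).trans ?_
  exact (K.idV_comp ε).trans (K.comp_id ε).symm

/-- Extending along a unit changes nothing up to isomorphism. The boundary `a` is only assumed equal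
to the identity because the lemma is applied to `F.map (𝟙 A')`. -/
theorem IsLeftKan.exists_vertIso_of_unit {A M : K.Obj} {I : K.Hor A A}
    {a : A ⟶ A} (ha : a = 𝟙 A) {ε : K.Cell (.of I) a a (.nul A)} {κ : K.Cell (.nil A) a a (.un I)}
    (haa : a ≫ a = a) (hκε : K.comp (.single κ rfl) ε haa haa = K.idV a)
    (hεκ : K.comp (.single ε rfl) κ haa haa = K.idH I ha ha)
    {f g : A ⟶ M} {χ : K.Cell (.of I) f g (.nul M)} (hχ : K.IsLeftKan χ) :
    ∃ θ : K.VertIso f g,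
      θ.hom = K.comp (.single κ rfl) χ (by simp [ha]) (by simp [ha]) := by
  subst ha
  have hf := Category.id_comp f
  have hg := Category.id_comp g
  set θ := K.comp (.single κ rfl) χ hf hg with hθ
  have hχθ : K.comp (.single ε rfl) θ hf hg = χ := by
    refine (K.comp_comp (.single ε rfl) κ rfl χ (Category.comp_id _) (Category.comp_id _)
      hf hg hf hg hf hg).symm.trans ?_
    exact (comp_single_congr hεκ).trans (K.comp_id χ)
  -- The inverse of `θ = χ ∘ κ`: it is the cell with `χ ⊙ ξ = id_f ∘ ε`. Precomposing with `κ` gives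
  -- `θ ⊙ ξ = id_f`.
  obtain ⟨ξ, hξ, -⟩ := hχ.existsUnique (H := .nil A) rfl (K.comp (.single ε rfl) (K.idV f) hf hf)
  have h1 : K.hcomp θ ξ rfl = K.idV f := by
    have h2 := K.comp_hcomp_vert (.single κ rfl) χ ξ hf hg hf
    refine (h2.trans (hcomp_congr rfl (K.comp_id ξ))).symm.trans ?_
    refine (congrArg (fun c => K.comp (.single κ rfl) c hf hf) hξ).trans ?_
    refine (K.comp_comp (.single κ rfl) ε rfl (K.idV f) (Category.comp_id _) (Category.comp_id _)
      hf hf hf hf hf hf).symm.trans ?_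
    exact (comp_single_congr hκε).trans (K.comp_id (K.idV f))
  refine ⟨⟨θ, ξ, h1, (hχ.bijective (H := .nil A) rfl g).1 ?_⟩, rfl⟩
  -- For the other composite, `χ ⊙ (ξ ⊙ θ) = (θ ⊙ ξ ⊙ θ) ∘ ε = θ ∘ ε = χ`.
  have h3 : ∀ {k : A ⟶ M} (ζ : K.Cell (.nil A) g k (.nul M)), K.hcomp χ ζ rfl =
      K.comp (.single ε rfl) (K.hcomp θ ζ rfl) hf (Category.id_comp k) := by
    intro k ζ
    have h4 := K.comp_hcomp_vert (.single ε rfl) θ ζ hf hg (Category.id_comp k)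
    exact (h4.trans (hcomp_congr hχθ (K.comp_id ζ))).symm
  refine (h3 _).trans ((comp_congr ?_).trans (h3 _).symm)
  exact ((K.hcomp_assoc θ ξ θ rfl rfl rfl rfl).symm.trans (hcomp_congr h1 rfl)).trans
    ((K.idV_hcomp θ).trans (K.hcomp_idV θ).symm)

/-- Right composites are unique up to invertible cells. -/
theorem RightComposite.exists_comparison {A X B : K.Obj} {H₁ : K.Hor A X} {H₂ : K.Hor X B}
    {J J' : K.Hor A B} (φ : K.RightComposite H₁ H₂ J) (φ' : K.RightComposite H₁ H₂ J') :
    ∃ α : K.Cell (.of J) (𝟙 A) (𝟙 B) (.un J'), K.IsCartesian (S := .un J) α ∧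
      K.comp (.single φ.cell rfl) α (Category.comp_id _) (Category.comp_id _) = φ'.cell := by
  have hA := Category.comp_id (𝟙 A)
  have hB := Category.comp_id (𝟙 B)
  have key : ∀ {J J' : K.Hor A B} (φ : K.RightComposite H₁ H₂ J) (φ' : K.RightComposite H₁ H₂ J')
      (α : K.Cell (.of J) (𝟙 A) (𝟙 B) (.un J')) (β : K.Cell (.of J') (𝟙 A) (𝟙 B) (.un J)),
      K.comp (.single φ.cell rfl) α hA hB = φ'.cell →
      K.comp (.single φ'.cell rfl) β hA hB = φ.cell →
      K.comp (.single α rfl) β hA hB = K.idH J rfl rfl := by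
    intro J J' φ φ' α β hα hβ
    refine (IsWeaklyUnaryCocartesian.bijective φ.cocartesian.1.2.1 hA hB).1 ?_
    refine (K.comp_comp (.single φ.cell rfl) α rfl β hA hB hA hB hA hB hA hB).symm.trans ?_
    exact ((comp_single_congr hα).trans hβ).trans (K.idH_comp φ.cell).symm
  obtain ⟨α, hα⟩ := (IsWeaklyUnaryCocartesian.bijective φ.cocartesian.1.2.1 hA hB).2 φ'.cell
  obtain ⟨β, hβ⟩ := (IsWeaklyUnaryCocartesian.bijective φ'.cocartesian.1.2.1 hA hB).2 φ.cell
  exact ⟨α, isCartesian_of_inverse (S := .un J) (T := .un J') α β (key φ φ' α β hα hβ)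
    (key φ' φ β α hβ hα), hα⟩

/-- A morphism from a unital object is full and faithful if every horizontal endomorphism is the
source of a cartesian left Kan cell with the given morphism as its vertical source. -/
theorem IsUnital.isFullyFaithful {A M : K.Obj} (hA : K.IsUnital A) {y : A ⟶ M}
    (hy : ∀ I : K.Hor A A, ∃ (l : A ⟶ M) (χ : K.Cell (.of I) y l (.nul M)),
      K.IsCartesian (S := .un I) χ ∧ K.IsLeftKan χ) : K.IsFullyFaithful y := by
  obtain ⟨I, ε, κ, hκε, hεκ⟩ := hA.exists_unit
  obtain ⟨l, χ, hχ, hχ'⟩ := hy I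
  obtain ⟨θ, hθ⟩ := hχ'.exists_vertIso_of_unit rfl _ hκε hεκ
  -- The cell `κ` is invertible, hence cartesian, so `θ = χ ∘ κ` is cartesian as well; the identity
  -- cell of `y` is `θ ⊙ θ⁻¹`.
  have h1 : K.IsCartesian (S := .nul A) θ.hom := by
    rw [hθ]
    exact IsCartesian.comp (isCartesian_of_inverse (S := .nul A) (T := .un I) κ ε hκε hεκ) hχ
      (Category.id_comp y) (Category.id_comp l)
  have h2 := θ.hom_inv
  rw [IsFullyFaithful, ← h2]
  exact IsCartesian.hcomp_vertIso h1 θ.symm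

end Kan

end AugVDC

namespace AugVDCFunctor

open AugVirt AugVDC

/-! ### The action of `ε ∘ F-` on cells -/

section Whisker

variable {K : AugVDC.{u, v, w, x}} {L : AugVDC.{u', v', w', x'}} (F : AugVDCFunctor K L)

/-- The composite `ε ∘ F φ`. -/
def whiskerCell {A B M : K.Obj} {N : L.Obj} {P : HPath K.Hor A B} {f : A ⟶ M} {g : B ⟶ M}
    (φ : K.Cell P f g (.nul M)) (ε : F.obj M ⟶ N) {f' : F.obj A ⟶ N} {g' : F.obj B ⟶ N}
    (hf : F.map f ≫ ε = f') (hg : F.map g ≫ ε = g') : L.Cell (F.onPath P) f' g' (.nul N) :=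
  L.comp (.single (F.onCell φ) rfl) (L.idV ε) hf hg

theorem whiskerCell_hcomp {A B C M : K.Obj} {N : L.Obj} {P₁ : HPath K.Hor A B}
    {P₂ : HPath K.Hor B C} {P : HPath K.Hor A C} {f : A ⟶ M} {g : B ⟶ M} {h : C ⟶ M}
    (φ : K.Cell P₁ f g (.nul M)) (ψ : K.Cell P₂ g h (.nul M)) (hP : P = P₁.comp P₂)
    (hP' : F.onPath P = (F.onPath P₁).comp (F.onPath P₂))
    (ε : F.obj M ⟶ N) {f' : F.obj A ⟶ N} {g' : F.obj B ⟶ N} {h' : F.obj C ⟶ N}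
    (hf : F.map f ≫ ε = f') (hg : F.map g ≫ ε = g') (hh : F.map h ≫ ε = h') :
    F.whiskerCell (K.hcomp φ ψ hP) ε hf hh =
      L.hcomp (F.whiskerCell φ ε hf hg) (F.whiskerCell ψ ε hg hh) hP' := by
  subst hf hg hh
  exact (comp_single_congr (F.onCell_hcomp φ ψ hP)).trans (L.whisker_hcomp _ _ _ ε)

theorem whiskerCell_idV {A M : K.Obj} {N : L.Obj} (f : A ⟶ M) (ε : F.obj M ⟶ N)
    {f' : F.obj A ⟶ N} (hf : F.map f ≫ ε = f') :
    F.whiskerCell (K.idV f) ε hf hf = L.idV f' :=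
  (comp_single_congr (F.onCell_idV f)).trans (L.idV_comp_idV' hf)

theorem whiskerCell_comp {A B C D M : K.Obj} {N : L.Obj} {P : HPath K.Hor A B}
    {Q : HPath K.Hor C D} {f : A ⟶ C} {g : B ⟶ D} {h : C ⟶ M} {k : D ⟶ M}
    (s : CellSeq K.toGraph P f g Q) (φ : K.Cell Q h k (.nul M)) {f' : A ⟶ M} {g' : B ⟶ M}
    (hf : f ≫ h = f') (hg : g ≫ k = g') (ε : F.obj M ⟶ N) {h' : F.obj C ⟶ N} {k' : F.obj D ⟶ N}
    {f'' : F.obj A ⟶ N} {g'' : F.obj B ⟶ N} (hf' : F.map f' ≫ ε = f'')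
    (hg' : F.map g' ≫ ε = g'') (hh : F.map h ≫ ε = h') (hk : F.map k ≫ ε = k')
    (hf'' : F.map f ≫ h' = f'') (hg'' : F.map g ≫ k' = g'') :
    F.whiskerCell (K.comp s φ hf hg) ε hf' hg' =
      L.comp (F.onSeq s) (F.whiskerCell φ ε hh hk) hf'' hg'' := by
  have hf₁ : F.map f ≫ F.map h = F.map f' := by
    subst hf; exact (F.onVert.map_comp f h).symm
  have hg₁ : F.map g ≫ F.map k = F.map g' := by
    subst hg; exact (F.onVert.map_comp g k).symm
  exact (comp_single_congr (F.onCell_comp' s φ hf hg hf₁ hg₁)).trans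
    (L.comp_comp _ _ _ _ _ _ _ _ _ _ _ _)

variable {F}

/-- Morphisms of the slice categories are pairs of a path and a cell. Since `ε ∘ F-` leaves the path
unchanged, its full faithfulness restricts to cells over each fixed path. -/
theorem IsLocallyUniversal.bijective {M : K.Obj} {N : L.Obj} {ε : F.obj M ⟶ N}
    (hε : F.IsLocallyUniversal ε) {A B : K.Obj} (P : HPath K.Hor A B) (f : A ⟶ M) (g : B ⟶ M)
    {f' : F.obj A ⟶ N} {g' : F.obj B ⟶ N} (hf : F.map f ≫ ε = f') (hg : F.map g ≫ ε = g') :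
    Function.Bijective fun φ : K.Cell P f g (.nul M) => F.whiskerCell φ ε hf hg := by
  subst hf hg
  obtain ⟨hfull, hfaithful⟩ := hε
  let X : K.Slice M := ⟨A, f⟩
  let Y : K.Slice M := ⟨B, g⟩
  constructor
  · intro φ ψ h
    have h1 : (⟨P, φ⟩ : AugVDC.Slice.Hom X Y) = ⟨P, ψ⟩ :=
      hfaithful.map_injective (X := X) (Y := Y)
        (congrArg (fun c => (⟨P, c⟩ : Slice.Hom ((F.sliceFunctor ε).obj X)
          ((F.sliceFunctor ε).obj Y))) h)
    cases h1
    rfl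
  · intro ψ
    obtain ⟨⟨Q, φ⟩, h⟩ := hfull.map_surjective (X := X) (Y := Y)
      (⟨P, ψ⟩ : Slice.Hom ((F.sliceFunctor ε).obj X) ((F.sliceFunctor ε).obj Y))
    have h1 : (⟨Q, F.whiskerCell φ ε rfl rfl⟩ : Slice.Hom ((F.sliceFunctor ε).obj X)
      ((F.sliceFunctor ε).obj Y)) = ⟨P, ψ⟩ := h
    cases h1
    exact ⟨φ, rfl⟩

/-- The image of a vertical isomorphism under `ε ∘ F-`. -/
def whiskerIso {A M : K.Obj} {N : L.Obj} {f g : A ⟶ M} (θ : K.VertIso f g) (ε : F.obj M ⟶ N)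
    {f' g' : F.obj A ⟶ N} (hf : F.map f ≫ ε = f') (hg : F.map g ≫ ε = g') :
    L.VertIso f' g' where
  hom := F.whiskerCell θ.hom ε hf hg
  inv := F.whiskerCell θ.inv ε hg hf
  hom_inv := (F.whiskerCell_hcomp θ.hom θ.inv rfl rfl ε hf hg hf).symm.trans
    ((congrArg (fun c => F.whiskerCell c ε hf hf) θ.hom_inv).trans (F.whiskerCell_idV f ε hf))
  inv_hom := (F.whiskerCell_hcomp θ.inv θ.hom rfl rfl ε hg hf hg).symm.trans
    ((congrArg (fun c => F.whiskerCell c ε hg hg) θ.inv_hom).trans (F.whiskerCell_idV g ε hg))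

theorem IsLocallyUniversal.exists_vertIso {M : K.Obj} {N : L.Obj} {ε : F.obj M ⟶ N}
    (hε : F.IsLocallyUniversal ε) {A : K.Obj} {f g : A ⟶ M}
    {f' g' : F.obj A ⟶ N} (hf : F.map f ≫ ε = f') (hg : F.map g ≫ ε = g')
    (σ : L.VertIso f' g') : Nonempty (K.VertIso f g) := by
  obtain ⟨a, ha⟩ := (hε.bijective (.nil A) f g hf hg).2 σ.hom
  obtain ⟨b, hb⟩ := (hε.bijective (.nil A) g f hg hf).2 σ.inv
  refine ⟨⟨a, b, (hε.bijective (.nil A) f f hf hf).1 ?_,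
    (hε.bijective (.nil A) g g hg hg).1 ?_⟩⟩
  · exact ((F.whiskerCell_hcomp a b rfl rfl ε hf hg hf).trans (hcomp_congr ha hb)).trans
      (σ.hom_inv.trans (F.whiskerCell_idV f ε hf).symm)
  · exact ((F.whiskerCell_hcomp b a rfl rfl ε hg hf hg).trans (hcomp_congr hb ha)).trans
      (σ.inv_hom.trans (F.whiskerCell_idV g ε hg).symm)

/-- `ε ∘ F-` reflects left Kan cells. -/
theorem IsLocallyUniversal.isLeftKan {M : K.Obj} {N : L.Obj} {ε : F.obj M ⟶ N}
    (hε : F.IsLocallyUniversal ε) {A B : K.Obj} {P : HPath K.Hor A B} {d : A ⟶ M} {l : B ⟶ M}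
    {η : K.Cell P d l (.nul M)} {d' d'' : F.obj A ⟶ N} {l' : F.obj B ⟶ N}
    (hd : F.map d ≫ ε = d') (hl : F.map l ≫ ε = l') (σ : L.VertIso d'' d')
    (h : L.IsLeftKan (L.hcomp σ.hom (F.whiskerCell η ε hd hl) (P := F.onPath P) rfl)) :
    K.IsLeftKan η := by
  refine isLeftKan_of_bijective fun H k => ?_
  have hPH : F.onPath (P.comp H) = (F.onPath P).comp (F.onPath H) := HPath.map_comp _ _ _ _
  -- Functoriality gives `σ ⊙ εF(η ⊙ φ) = (σ ⊙ εFη) ⊙ εFφ`, where every map other than `η ⊙ -` is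
  -- known to be bijective.
  refine (Function.Bijective.of_comp_iff' ((σ.hcomp_left_bijective (F.onPath (P.comp H)) _).comp
    (hε.bijective (P.comp H) d k hd rfl)) _).1 ?_
  refine (congrArg Function.Bijective ?_).mp
    ((h.bijective hPH _).comp (hε.bijective H l k hl rfl))
  funext φ
  refine (L.hcomp_assoc σ.hom (F.whiskerCell η ε hd hl) (F.whiskerCell φ ε hl rfl)
    rfl hPH hPH rfl).trans ?_
  exact hcomp_congr rfl (F.whiskerCell_hcomp η φ rfl hPH ε hd hl rfl).symm

theorem IsUniversalRelative.exists_vertIso {M : K.Obj} {N : L.Obj} {ε : F.obj M ⟶ N}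
    {𝒥 : ObjectProperty (F.Slice N)} (hε : F.IsUniversalRelative ε 𝒥) {B : K.Obj}
    {g : F.obj B ⟶ N} (hg : 𝒥 ⟨B, g⟩) :
    ∃ f : B ⟶ M, Nonempty (L.VertIso (F.map f ≫ ε) g) := by
  obtain ⟨-, h, heq⟩ := hε
  obtain ⟨⟨A, f⟩, ⟨e⟩⟩ := heq.essSurj.mem_essImage ⟨⟨B, g⟩, hg⟩
  have e' : (⟨A, F.map f ≫ ε⟩ : F.Slice N) ≅ ⟨B, g⟩ := 𝒥.ι.mapIso e
  obtain ⟨⟨P, φ⟩, ⟨Q, ψ⟩, h1, h2⟩ := e'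
  -- Paths compose to the empty path only if both are empty. So isomorphic objects of `F / N` have
  -- the same base, and the isomorphism is a vertical one.
  have h3 : P.comp Q = .nil A := congrArg Slice.Hom.path h1
  cases P with
  | cons J P => cases h3
  | nil =>
    cases Q with
    | cons J Q => cases h3
    | nil =>
      exact ⟨f, ⟨⟨φ, ψ, eq_of_heq (Slice.Hom.mk.inj h1).2, eq_of_heq (Slice.Hom.mk.inj h2).2⟩⟩⟩

end Whisker

end AugVDCFunctor

/-! ### Left Kan cells supplied by density -/

namespace AugVDC

open AugVirt

/-- The left Kan cell induced by a right composite from cartesian cells along a dense morphism. -/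
theorem IsDense.exists_isLeftKan {L : AugVDC.{u, v, w, x}} {A X B M : L.Obj} {y : A ⟶ M}
    (hy : L.IsDense y) {H₁ : L.Hor A X} {H₂ : L.Hor X B} {J : L.Hor A B}
    (φ : L.RightComposite H₁ H₂ J) {l : X ⟶ M} (η : L.Restriction (.nul M) y l H₁) {l' : B ⟶ M}
    (η' : L.Restriction (.nul M) y l' J) :
    ∃ χ : L.Cell (.of H₂) l l' (.nul M),
      L.comp (.single φ.cell rfl) η'.cell (Category.id_comp y) (Category.id_comp l') =
        L.hcomp η.cell χ rfl ∧ L.IsLeftKan χ := by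
  have h : L.IsLeftKan η.cell := hy H₁ l η
  obtain ⟨χ, hχ, -⟩ := h.existsUnique (H := .of H₂) rfl
    (L.comp (.single φ.cell rfl) η'.cell (Category.id_comp y) (Category.id_comp l'))
  exact ⟨χ, hχ.symm, IsLeftKan.of_hcomp φ.cocartesian.1.1 h (hy J l' η') hχ.symm⟩

end AugVDC

namespace AugVDCFunctor

open AugVirt AugVDC

/-! ### Existence of the choices and the cells `χ♯` -/

section Yoneda

variable {K : AugVDC.{u, v, w, x}} {L : AugVDC.{u', v', w', x'}} {F : AugVDCFunctor K L}
  {A M : L.Obj} {A' M' : K.Obj} {ι : L.Hor A (F.obj A')} {y : A ⟶ M} {ε : F.obj M' ⟶ M}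

/-- The image of a horizontal unit induces vertical isomorphisms from left Kan cells. -/
theorem exists_vertIso_of_unit {I : K.Hor A' A'} {e : K.Cell (.of I) (𝟙 A') (𝟙 A') (.nul A')}
    {κ : K.Cell (.nil A') (𝟙 A') (𝟙 A') (.un I)}
    (hκe : K.comp (.single κ rfl) e (Category.comp_id _) (Category.comp_id _) = K.idV (𝟙 A'))
    (heκ : K.comp (.single e rfl) κ (Category.comp_id _) (Category.comp_id _) =
      K.idH I rfl rfl) {f g : F.obj A' ⟶ M} {χ : L.Cell (.of (F.onHor I)) f g (.nul M)}
    (hχ : L.IsLeftKan χ) : Nonempty (L.VertIso f g) := by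
  have h : F.map (𝟙 A') ≫ F.map (𝟙 A') = F.map (𝟙 A') :=
    (F.onVert.map_comp _ _).symm.trans (congrArg F.map (Category.comp_id _))
  obtain ⟨θ, -⟩ := hχ.exists_vertIso_of_unit (F.onVert.map_id A') (ε := F.onCell e)
    (κ := F.onCell κ) h
    ((F.onCell_comp' (.single κ rfl) e _ _ h h).symm.trans
      ((congrArg F.onCell hκe).trans (F.onCell_idV (𝟙 A'))))
    ((F.onCell_comp' (.single e rfl) κ _ _ h h).symm.trans
      ((congrArg F.onCell heκ).trans (F.onCell_idH I)))
  exact ⟨θ⟩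

theorem isSmall_of_restriction (hy : L.IsDense y) {B : K.Obj} {J : K.Hor A' B}
    {Jflat : L.Hor A (F.obj B)} (φ : L.RightComposite ι (F.onHor J) Jflat) {l : F.obj B ⟶ M}
    (η : L.Restriction (.nul M) y l Jflat) : F.IsSmall ι y ⟨B, l⟩ :=
  ⟨J, Jflat, ⟨φ⟩, η.cell, hy Jflat l η⟩

theorem nonempty_yonedaChoice (hy : L.IsYonedaMorphism y) (hA' : K.IsUnital A')
    (hι : F.HasAdjuncts ι) (hε : F.IsUniversalRelative ε (F.IsSmall ι y)) :
    Nonempty (F.YonedaChoice ι y ε) := by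
  choose flat cocart using @hι
  choose lam cart using fun (B : K.Obj) (J : K.Hor A' B) => hy.yoneda (flat J)
  choose lam' iso using fun (B : K.Obj) (J : K.Hor A' B) =>
    hε.exists_vertIso (isSmall_of_restriction hy.dense (cocart J).some (cart B J).some)
  obtain ⟨lamι, ⟨cartι⟩⟩ := hy.yoneda ι
  -- The unit `I` makes `lamι` isomorphic to the small morphism `lam I`, so `lam' I` can serve as
  -- `y'`.
  obtain ⟨I, e, κ, hκe, heκ⟩ := IsUnital.exists_unit hA'
  obtain ⟨χ, -, hχ⟩ := IsDense.exists_isLeftKan hy.dense (cocart I).some cartι (cart _ I).some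
  obtain ⟨θ⟩ := exists_vertIso_of_unit hκe heκ hχ
  exact ⟨{
    flat := flat
    cocart := fun J => (cocart J).some
    lamι := lamι
    cartι := cartι
    lam := lam _
    cart := fun J => (cart _ J).some
    y' := lam' _ I
    isoι := θ.trans (iso _ I).some.symm
    lam' := lam' _
    iso := fun J => (iso _ J).some }⟩

namespace YonedaChoice

variable (c : F.YonedaChoice ι y ε)

theorem existsUnique_isChiSharp (hy : L.IsDense y) (hε : F.IsLocallyUniversal ε) {B : K.Obj}
    (J : K.Hor A' B) : ∃! χ', c.IsChiSharp J χ' := by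
  obtain ⟨χ, hχ, -⟩ := IsDense.exists_isLeftKan hy (c.cocart J) c.cartι (c.cart J)
  -- The passage from `χ'` to `σ ⊙ εFχ' ⊙ τ_J` is bijective; `χ` itself is unique because `cartι` is
  -- left Kan.
  have hb := ((c.iso J).hcomp_right_bijective (.of (F.onHor J)) _).comp
    ((c.isoι.hcomp_left_bijective (.of (F.onHor J)) _).comp
      (hε.bijective (.of J) c.y' (c.lam' J) rfl rfl))
  obtain ⟨χ', h⟩ := hb.2 χ
  refine ⟨χ', ⟨χ, hχ, h.symm⟩, ?_⟩
  rintro ψ ⟨χ₁, hχ₁, hψ⟩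
  refine hb.1 (Eq.trans ?_ h.symm)
  exact hψ.symm.trans ((IsLeftKan.bijective (hy ι _ c.cartι) rfl _).1 (hχ₁.symm.trans hχ))

theorem isLeftKan_of_isChiSharp (hy : L.IsDense y) (hε : F.IsLocallyUniversal ε) {B : K.Obj}
    {J : K.Hor A' B} {χ' : K.Cell (.of J) c.y' (c.lam' J) (.nul M')} (h : c.IsChiSharp J χ') :
    K.IsLeftKan χ' := by
  obtain ⟨χ, hχ, hχ'⟩ := h
  have h1 : L.IsLeftKan χ := IsLeftKan.of_hcomp (c.cocart J).cocartesian.1.1 (hy ι _ c.cartι)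
    (hy _ _ (c.cart J)) hχ
  rw [hχ'] at h1
  have h2 : L.IsLeftKan (L.hcomp c.isoι.hom (F.whiskerCell χ' ε rfl rfl)
      (P := F.onPath (.of J)) rfl) := IsLeftKan.of_hcomp_vertIso (c.iso J) h1
  intro C H k
  exact hε.isLeftKan rfl rfl c.isoι h2 H k

/-- The assignment defining the local universality of `ι` is bijective precisely if composition
with the adjunct of `χ` is so. -/
theorem transpose_bijective_iff (hy : L.IsDense y) (hε : F.IsLocallyUniversal ε) {B : K.Obj}
    {J : K.Hor A' B} {χ' : K.Cell (.of J) c.y' (c.lam' J) (.nul M')} (hs : c.IsChiSharp J χ')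
    {Jflat : L.Hor A (F.obj B)} (cocart : L.RightComposite ι (F.onHor J) Jflat)
    {X Y : K.Obj} {h : X ⟶ A'} {ιh : L.Hor A (F.obj X)} (cart : L.Restriction (.un ι) (𝟙 A) (F.map h) ιh)
    (P : HPath K.Hor X Y) (k : Y ⟶ B) :
    (Function.Bijective fun φ : K.Cell P h k (.un J) => F.transpose cocart cart φ) ↔
      Function.Bijective fun φ : K.Cell P h k (.un J) =>
        K.comp (.single φ rfl) χ' (f' := h ≫ c.y') (g' := k ≫ c.lam' J) rfl rfl := by
  obtain ⟨χ, hχ, hχ'⟩ := hs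
  have hyid := Category.id_comp y
  have hlid := Category.id_comp (c.lam J)
  -- Condition (c) refers to an arbitrary right composite, while `χ` is built from the chosen one.
  -- The comparison `α` turns the chosen cartesian cell into a cartesian cell `η` on `Jflat`.
  obtain ⟨α, hα, hα'⟩ := cocart.exists_comparison (c.cocart J)
  let η : L.Cell (.of Jflat) y (c.lam J) (.nul M) :=
    L.comp (.single α rfl) (c.cart J).cell hyid hlid
  have hη : L.IsCartesian (S := .un Jflat) η := IsCartesian.comp hα (c.cart J).cartesian hyid hlid
  have hηχ : L.comp (.single cocart.cell rfl) η hyid hlid = L.hcomp c.cartι.cell χ rfl := by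
    refine (L.comp_comp (.single cocart.cell rfl) α rfl (c.cart J).cell (Category.comp_id _)
      (Category.comp_id _) hyid hlid hyid hlid hyid hlid).symm.trans ?_
    exact (comp_single_congr hα').trans hχ
  let ζ : L.Restriction (.nul M) y (F.map h ≫ c.lamι) ιh :=
    ⟨L.comp (.single cart.cell rfl) c.cartι.cell hyid rfl,
      IsCartesian.comp cart.cartesian c.cartι.cartesian hyid rfl⟩
  have hh : F.map (h ≫ c.y') ≫ ε = F.map h ≫ F.map c.y' ≫ ε :=
    (congrArg (· ≫ ε) (F.onVert.map_comp _ _)).trans (Category.assoc _ _ _)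
  have hk : F.map (k ≫ c.lam' J) ≫ ε = F.map k ≫ F.map (c.lam' J) ≫ ε :=
    (congrArg (· ≫ ε) (F.onVert.map_comp _ _)).trans (Category.assoc _ _ _)
  let σ := c.isoι.precomp (F.map h) rfl rfl
  let τ := (c.iso J).precomp (F.map k) rfl rfl
  -- `hT` carries cells `P ⇒ M'` to cells `ιh ⌢ FP ⇒ M`; the cell `ζ` is left Kan since it is
  -- cartesian and `y` is dense. `hS` carries the transposed cells to the same set, by composition
  -- with `η`.
  have hT := (IsLeftKan.bijective (hy _ _ ζ) (R := (HPath.of ιh).comp (F.onPath P)) rfl _).comp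
    ((τ.hcomp_right_bijective (F.onPath P) _).comp
      ((σ.hcomp_left_bijective (F.onPath P) _).comp
        (hε.bijective P (h ≫ c.y') (k ≫ c.lam' J) hh hk)))
  have hS := hη.bijective ((HPath.of ιh).comp (F.onPath P)) (𝟙 A) (F.map k) hyid rfl
  rw [← Function.Bijective.of_comp_iff' hS, ← Function.Bijective.of_comp_iff' hT]
  refine iff_of_eq (congrArg Function.Bijective (funext fun φ => ?_))
  refine (L.comp_comp (.cons cart.cell (.single (F.onCell φ) rfl) rfl rfl) cocart.cell rfl η
    (Category.comp_id _) (Category.comp_id _) hyid rfl hyid hlid hyid rfl).trans ?_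
  refine (comp_congr hηχ).trans ?_
  refine (L.comp_hcomp (.single cart.cell rfl) (.single (F.onCell φ) rfl) c.cartι.cell χ rfl rfl
    hyid rfl rfl).trans ?_
  refine hcomp_congr rfl ?_
  refine (comp_congr hχ').trans ?_
  refine (L.comp_hcomp_vert (.single (F.onCell φ) rfl) _ (c.iso J).hom rfl rfl rfl).trans ?_
  refine hcomp_congr ?_ rfl
  refine (L.comp_vert_hcomp (.single (F.onCell φ) rfl) c.isoι.hom _ rfl rfl rfl).trans ?_
  refine hcomp_congr rfl ?_
  exact (F.whiskerCell_comp (.single φ rfl) χ' rfl rfl ε hh hk rfl rfl rfl rfl).symm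

/-- Condition (c) and cartesianness range over the same `h`, `k` and `P`. In the forward direction,
condition (b) supplies the restriction along which to transpose. -/
theorem isLocallyUniversalHor_iff (hy : L.IsDense y) (hε : F.IsLocallyUniversal ε)
    (hιa : F.HasAdjuncts ι) (hιb : F.HasRightRestrictions ι) :
    F.IsLocallyUniversalHor ι ↔
      ∀ {B : K.Obj} (J : K.Hor A' B) (χ' : K.Cell (.of J) c.y' (c.lam' J) (.nul M')),
        c.IsChiSharp J χ' → K.IsCartesian (S := .un J) χ' := by
  refine ⟨fun hι B J χ' h => ?_, fun h => ⟨hιa, hιb, fun J Jflat cocart X Y p ιh cart P k => ?_⟩⟩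
  · refine isCartesian_of_bijective fun P p k => ?_
    obtain ⟨ιp, ⟨cart⟩⟩ := hιb p
    exact (c.transpose_bijective_iff hy hε h (c.cocart J) cart P k).1
      (hι.bijective J _ (c.cocart J) p ιp cart P k)
  · obtain ⟨χ', hχ', -⟩ := c.existsUnique_isChiSharp hy hε J
    exact (c.transpose_bijective_iff hy hε hχ' cocart cart P k).2
      (IsCartesian.bijective (S := .un J) (h J χ' hχ') P p k rfl rfl)

/-- Every vertical morphism into `M'` is isomorphic to a chosen one. -/
theorem exists_vertIso_lam' (hy : L.IsDense y) (hε : F.IsUniversalRelative ε (F.IsSmall ι y))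
    {B : K.Obj} (l : B ⟶ M') : ∃ H : K.Hor A' B, Nonempty (K.VertIso (c.lam' H) l) := by
  obtain ⟨hε', hsmall, -⟩ := hε
  -- The morphism `ε ∘ Fl` is small, so both it and `lam H` are left Kan extensions of `y` along
  -- `Hflat`. The resulting isomorphism `ε ∘ F(lam' H) ≅ ε ∘ Fl` lifts along `ε ∘ F-`.
  obtain ⟨H, Hflat, ⟨φ⟩, η, hη⟩ := hsmall ⟨B, l⟩
  obtain ⟨α, hα, -⟩ := φ.exists_comparison (c.cocart H)
  obtain ⟨θ, -⟩ := IsLeftKan.exists_vertIso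
    (hy Hflat (c.lam H) ⟨L.comp (.single α rfl) (c.cart H).cell (Category.id_comp _)
      (Category.id_comp _), IsCartesian.comp hα (c.cart H).cartesian _ _⟩) hη
  exact ⟨H, hε'.exists_vertIso rfl rfl ((c.iso H).trans θ)⟩

/-- After transport along `lam' H ≅ l`, the cell `χ♯` of `H` is both cartesian and left Kan with the
same boundary as `η`, while `χ♯` of `J` is a left Kan cell with the same source as `η`. -/
theorem isDense (hy : L.IsDense y) (hε : F.IsUniversalRelative ε (F.IsSmall ι y))
    (hχ : ∀ {B : K.Obj} (J : K.Hor A' B) (χ' : K.Cell (.of J) c.y' (c.lam' J) (.nul M')),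
      c.IsChiSharp J χ' → K.IsCartesian (S := .un J) χ') : K.IsDense c.y' := by
  intro B J l η
  obtain ⟨χ, hχJ, -⟩ := c.existsUnique_isChiSharp hy hε.1 J
  obtain ⟨H, ⟨θ⟩⟩ := c.exists_vertIso_lam' hy hε l
  obtain ⟨χH, hχH, -⟩ := c.existsUnique_isChiSharp hy hε.1 H
  exact IsLeftKan.of_isCartesian η.cartesian
    (IsCartesian.hcomp_vertIso (S := .un H) (hχ H χH hχH) θ)
    (IsLeftKan.hcomp_vertIso (c.isLeftKan_of_isChiSharp hy hε.1 hχH) θ)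
    (c.isLeftKan_of_isChiSharp hy hε.1 hχJ)

theorem yonedaAxiom (hy : L.IsDense y) (hε : F.IsLocallyUniversal ε)
    (hχ : ∀ {B : K.Obj} (J : K.Hor A' B) (χ' : K.Cell (.of J) c.y' (c.lam' J) (.nul M')),
      c.IsChiSharp J χ' → K.IsCartesian (S := .un J) χ') : K.YonedaAxiom c.y' := by
  intro B J
  obtain ⟨χ, h, -⟩ := c.existsUnique_isChiSharp hy hε J
  exact ⟨c.lam' J, ⟨⟨χ, hχ J χ h⟩⟩⟩

theorem isYonedaEmbedding (hy : L.IsDense y) (hA' : K.IsUnital A')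
    (hε : F.IsUniversalRelative ε (F.IsSmall ι y))
    (hχ : ∀ {B : K.Obj} (J : K.Hor A' B) (χ' : K.Cell (.of J) c.y' (c.lam' J) (.nul M')),
      c.IsChiSharp J χ' → K.IsCartesian (S := .un J) χ') : K.IsYonedaEmbedding c.y' where
  dense := c.isDense hy hε hχ
  yoneda := c.yonedaAxiom hy hε.1 hχ
  fullyFaithful := IsUnital.isFullyFaithful hA' fun I => by
    obtain ⟨χ, h, -⟩ := c.existsUnique_isChiSharp hy hε.1 I
    exact ⟨c.lam' I, χ, hχ I χ h, c.isLeftKan_of_isChiSharp hy hε.1 h⟩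

/-- The adjunct of the companion of `y'` is the nullary restriction of `M` along `y` and `ε`. -/
theorem nonempty_restriction (hy : L.IsDense y) (hε : F.IsLocallyUniversal ε)
    (hy' : K.IsDense c.y') {J : K.Hor A' M'} (comp : K.Companion c.y' J) :
    Nonempty (L.Restriction (.nul M) y ε (c.flat J)) := by
  obtain ⟨χ, h, -⟩ := c.existsUnique_isChiSharp hy hε J
  -- Density makes the companion cell left Kan, so `𝟙 M'` and `lam' J` are both left Kan extensions
  -- of `y'` along `J`. Applying `ε ∘ F-` to `θ` gives `lam J ≅ ε`.
  obtain ⟨θ, -⟩ := IsLeftKan.exists_vertIso (c.isLeftKan_of_isChiSharp hy hε h)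
    (hy' J (𝟙 M') comp)
  have hid : F.map (𝟙 M') ≫ ε = ε :=
    (congrArg (· ≫ ε) (F.onVert.map_id M')).trans (Category.id_comp ε)
  exact ⟨⟨_, IsCartesian.hcomp_vertIso (S := .un (c.flat J)) (c.cart J).cartesian
    ((c.iso J).symm.trans (F.whiskerIso θ ε rfl hid))⟩⟩

end YonedaChoice

end Yoneda

end AugVDCFunctor

/-! ### The theorem -/

theorem mainTheorem3 {K : AugVDC.{u, v, w, x}}
    {L : AugVDC.{u', v', w', x'}} (F : AugVDCFunctor K L)
    {A PA : L.Obj} (yA : A ⟶ PA) (hyA : L.IsYonedaMorphism yA)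
    {A' : K.Obj} (hA' : K.IsUnital A')
    (ι : L.Hor A (F.obj A')) (hιa : F.HasAdjuncts ι) (hιb : F.HasRightRestrictions ι)
    {PA' : K.Obj} (ε : F.obj PA' ⟶ PA) (hε : F.IsUniversalRelative ε (F.IsSmall ι yA)) :
    Nonempty (F.YonedaChoice ι yA ε) ∧
    ∀ c : F.YonedaChoice ι yA ε,
      (∀ {B : K.Obj} (J : K.Hor A' B), ∃! χ', c.IsChiSharp J χ') ∧
      (F.IsLocallyUniversalHor ι ↔
        ∀ {B : K.Obj} (J : K.Hor A' B) (χ' : K.Cell (.of J) c.y' (c.lam' J) (.nul PA')),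
          c.IsChiSharp J χ' → K.IsCartesian (S := .un J) χ') ∧
      (F.IsLocallyUniversalHor ι → K.YonedaAxiom c.y') ∧
      (∀ (yA'_c : K.Hor A' PA') (_hc : K.Companion c.y' yA'_c),
        (∀ {B : K.Obj} (f : B ⟶ PA'),
          K.HasRestriction (.un yA'_c) (𝟙 A') f ∧
          L.HasRestriction (.un (c.flat yA'_c)) (𝟙 A) (F.map f) ∧
          F.PreservesRestriction yA'_c (𝟙 A') f) →
        F.IsLocallyUniversalHor ι →
        K.IsYonedaEmbedding c.y' ∧
        (∀ {B : K.Obj} (J : K.Hor A' B) (χ' : K.Cell (.of J) c.y' (c.lam' J) (.nul PA')),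
          c.IsChiSharp J χ' → K.IsCartesian (S := .un J) χ') ∧
        Nonempty (L.Restriction (.nul PA) yA ε (c.flat yA'_c))) := by
  have hd : L.IsDense yA := hyA.dense
  refine ⟨AugVDCFunctor.nonempty_yonedaChoice hyA hA' hιa hε, fun c => ?_⟩
  have hiff := c.isLocallyUniversalHor_iff hd hε.1 hιa hιb
  refine ⟨fun J => c.existsUnique_isChiSharp hd hε.1 J, hiff,
    fun hι => c.yonedaAxiom hd hε.1 (hiff.1 hι), fun J comp _ hι => ?_⟩
  exact ⟨c.isYonedaEmbedding hd hA' hε (hiff.1 hι), hiff.1 hι,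
    c.nonempty_restriction hd hε.1 (c.isDense hd hε (hiff.1 hι)) comp⟩
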